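/- Let $p>2$ be prime and $d=p^2$. Let $X=\sum_{k\in\mathbb Z_d}|k+1\rangle\langle k|$ and $Z=\sum_{k\in\mathbb Z_d}\omega^k|k\rangle\langle k|$ with $\omega=e^{2\pi i/d}$. A GPM is a matrix $X^sZ^t$ with $0\le s,t<d$, and a GPM-triple is a set of three distinct GPMs. Two GPM-triples $\mathcal A,\mathcal B$ are U-equivalent if there are $d\times d$ unitaries $U_L,U_R$ and a bijection $\pi:\mathcal A\to\mathcal B$ such that, for every $A\in\mathcal A$, $A=U_L\,\pi(A)\,U_R$ up to a phase (which may depend on $A$). A generalized Bell state (GBS) is $(I\otimes X^sZ^t)|\phi_{0,0}\rangle$ with $0\le s,t<d$ and $|\phi_{0,0}\rangle=d^{-1/2}\sum_{k\in\mathbb Z_d}|kk\rangle$; a GBS-triple is a set of three distinct GBSs. Two GBS-triples $\mathcal S,\mathcal T$ are LU-equivalent if there are $d\times d$ unitaries $U_A,U_B$ and a bijection $\pi:\mathcal S\to\mathcal T$ such that, for every $\phi\in\mathcal S$, $\phi=(U_A\otimes U_B)\pi(\phi)$ up to a phase (which may depend on $\phi$). For $x\in\mathbb Z_n$ put $[x]_n=\{x,x^{-1},1-x,(1-x)^{-1},1-x^{-1},x(x-1)^{-1}\}$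 and $[[x]]_n=\{x,1-x^{-1},(1-x)^{-1}\}$, omitting the elements that involve an inverse which does not exist in $\mathbb Z_n$; minimal elements are taken in $\mathbb Z_n=\{0,\dots,n-1\}$. Then the number of U-equivalence classes of GPM-triples is exactly $$\left\lfloor\tfrac56p^2\right\rfloor+\left\lfloor\tfrac{p-2}{6}+(-1)^{\lfloor p/3\rfloor}\tfrac p3\right\rfloor+3 .$$ Moreover the following are GPM-triples, and every GPM-triple is U-equivalent to exactly one of them (triples with different parameters, or from different families, being U-inequivalent): 1. $\mathcal M_s=\{I,Z,X^s\}$ with $1\le s\le\lfloor p^2/2\rfloor$; these form $\lfloor p^2/2\rfloor$ classes. 2. $\mathcal N_{k,\hat s}=\{I,Z,X^{kp}Z^{\hat s}\}$ with $1\le k\le\frac{p-1}2$ and $\hat s$ the minimal element of $[[s]]_p$ for some $2\le s\le p-1$; these form $\lfloor\frac{p-1}2\rfloor\left(2\lfloor\frac p6\rfloor+1\right)$ classes. 3. $\mathcal N_{\hat s}=\{I,Z,Z^{\hat s}\}$ with $\hat s$ the minimal element of $[s]_{p^2}$ for some $2\le s<p^2$; these form $\lfloor\frac{p^2-2p+1}6\rfloor+\lfloor\frac{p-1}2\rfloor+1$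 classes. 4. $\mathcal M=\{I,Z^p,X^p\}$; this forms one class. 5. $\mathcal W_{\hat s}=\{I,Z^p,Z^{\hat sp}\}$ with $\hat s$ the minimal element of $[s]_p$ for some $2\le s\le p-1$; these form $\lfloor\frac p6\rfloor+1$ classes. The same statements, with the same counts, hold for GBS-triples up to LU-equivalence, the representatives being the images of the above triples under $M\mapsto(I\otimes M)|\phi_{0,0}\rangle$. -/

import Mathlib

open scoped Kronecker

noncomputable section

namespace GenBell

/-- Complex `d × d` matrices, rows and columns indexed by `ℤ/d` (computational basis `|k⟩`). -/
abbrev Mat (d : ℕ) : Type := Matrix (ZMod d) (ZMod d) ℂ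

/-- Shift operator `X = ∑ₖ |k+1⟩⟨k|`. -/
def shiftX (d : ℕ) : Mat d := Matrix.of fun i j => if i = j + 1 then 1 else 0

/-- Clock operator `Z = ∑ₖ ωᵏ |k⟩⟨k|`, `ω = exp(2πi/d)`. -/
def clockZ (d : ℕ) : Mat d :=
  Matrix.diagonal fun k => Complex.exp (2 * Real.pi * Complex.I / d) ^ k.val

/-- Generalized Pauli matrices `X^s Z^t`, `0 ≤ s, t < d`. -/
def IsGPM (d : ℕ) [NeZero d] (M : Mat d) : Prop :=
  ∃ s t : ℕ, s < d ∧ t < d ∧ M = shiftX d ^ s * clockZ d ^ t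

/-- GPM-triples: sets of three distinct generalized Pauli matrices. -/
def IsGPMTriple (d : ℕ) [NeZero d] (T : Set (Mat d)) : Prop :=
  T.ncard = 3 ∧ ∀ M ∈ T, IsGPM d M

/-- U-equivalence of two sets of matrices: `U_L 𝒩 U_R ≈ ℳ`, i.e. there are unitaries `U_L`, `U_R` and
a matching `π` of the elements with `M = U_L (π M) U_R` up to a phase (which may depend on `M`). -/
def UEquiv {d : ℕ} [NeZero d] (𝓜 𝓝 : Set (Mat d)) : Prop :=
  ∃ UL ∈ Matrix.unitaryGroup (ZMod d) ℂ, ∃ UR ∈ Matrix.unitaryGroup (ZMod d) ℂ, ∃ π : 𝓜 ≃ 𝓝,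
    ∀ M : 𝓜, ∃ c : ℂ, ‖c‖ = 1 ∧ (M : Mat d) = c • (UL * (π M : Mat d) * UR)

/-- State vectors of the `d ⊗ d` system in the basis `|jk⟩`. -/
abbrev Ket (d : ℕ) : Type := ZMod d × ZMod d → ℂ

/-- The standard maximally entangled state `d^{-1/2} ∑ₖ |kk⟩`. -/
def stdMES (d : ℕ) : Ket d := fun x => if x.1 = x.2 then ((Real.sqrt d : ℝ) : ℂ)⁻¹ else 0

/-- `(I ⊗ M)|φ₀₀⟩`, the state associated with the matrix `M`. -/
def toKet (d : ℕ) [NeZero d] (M : Mat d) : Ket d :=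
  Matrix.mulVec ((1 : Mat d) ⊗ₖ M) (stdMES d)

/-- Generalized Bell states `|φ_{s,t}⟩ = (I ⊗ X^s Z^t)|φ₀₀⟩`, `0 ≤ s, t < d`. -/
def IsGBS (d : ℕ) [NeZero d] (φ : Ket d) : Prop :=
  ∃ s t : ℕ, s < d ∧ t < d ∧ φ = toKet d (shiftX d ^ s * clockZ d ^ t)

/-- GBS-triples: sets of three distinct generalized Bell states. -/
def IsGBSTriple (d : ℕ) [NeZero d] (T : Set (Ket d)) : Prop :=
  T.ncard = 3 ∧ ∀ φ ∈ T, IsGBS d φ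

/-- LU-equivalence of two sets of states: `|φ⟩ ≈ (U_A ⊗ U_B)|π φ⟩` for unitaries `U_A`, `U_B` and a
matching `π` of the elements, up to a phase (which may depend on `φ`). -/
def LUEquiv {d : ℕ} [NeZero d] (S T : Set (Ket d)) : Prop :=
  ∃ UA ∈ Matrix.unitaryGroup (ZMod d) ℂ, ∃ UB ∈ Matrix.unitaryGroup (ZMod d) ℂ, ∃ π : S ≃ T,
    ∀ φ : S, ∃ c : ℂ, ‖c‖ = 1 ∧ (φ : Ket d) = c • Matrix.mulVec (UA ⊗ₖ UB) (π φ : Ket d)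

section equivalence

variable {d : ℕ} [NeZero d]

theorem UEquiv.refl (S : Set (Mat d)) : UEquiv S S :=
  ⟨1, one_mem _, 1, one_mem _, Equiv.refl _, fun M => ⟨1, by simp, by simp⟩⟩

theorem UEquiv.symm {S T : Set (Mat d)} : UEquiv S T → UEquiv T S := by
  rintro ⟨U, hU, V, hV, π, h⟩
  refine ⟨star U, Unitary.star_mem hU, star V, Unitary.star_mem hV, π.symm, fun M => ?_⟩
  obtain ⟨c, hc, e⟩ := h (π.symm M)
  have hc0 : c ≠ 0 := by rintro rfl; simp at hc
  refine ⟨c⁻¹, by simp [hc], ?_⟩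
  rw [Equiv.apply_symm_apply] at e
  have h1 : star U * U = 1 := (Unitary.mem_iff.1 hU).1
  have h2 : V * star V = 1 := (Unitary.mem_iff.1 hV).2
  have h3 : star U * (U * (M : Mat d) * V) * star V = M := by
    calc star U * (U * (M : Mat d) * V) * star V
        = (star U * U) * (M : Mat d) * (V * star V) := by simp only [mul_assoc]
      _ = M := by rw [h1, h2, one_mul, mul_one]
  rw [e, mul_smul_comm, smul_mul_assoc, h3, smul_smul, inv_mul_cancel₀ hc0, one_smul]

theorem UEquiv.trans {R S T : Set (Mat d)} : UEquiv R S → UEquiv S T → UEquiv R T := by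
  rintro ⟨U, hU, V, hV, π, h⟩ ⟨U', hU', V', hV', π', h'⟩
  refine ⟨U * U', mul_mem hU hU', V' * V, mul_mem hV' hV, π.trans π', fun M => ?_⟩
  obtain ⟨c, hc, e⟩ := h M
  obtain ⟨c', hc', e'⟩ := h' (π M)
  refine ⟨c * c', by simp [hc, hc'], ?_⟩
  rw [e, e', Equiv.trans_apply, mul_smul_comm, smul_mul_assoc, smul_smul]
  simp only [mul_assoc]

theorem LUEquiv.refl (S : Set (Ket d)) : LUEquiv S S :=
  ⟨1, one_mem _, 1, one_mem _, Equiv.refl _, fun M => ⟨1, by simp, by simp⟩⟩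

theorem LUEquiv.symm {S T : Set (Ket d)} : LUEquiv S T → LUEquiv T S := by
  rintro ⟨U, hU, V, hV, π, h⟩
  refine ⟨star U, Unitary.star_mem hU, star V, Unitary.star_mem hV, π.symm, fun M => ?_⟩
  obtain ⟨c, hc, e⟩ := h (π.symm M)
  have hc0 : c ≠ 0 := by rintro rfl; simp at hc
  refine ⟨c⁻¹, by simp [hc], ?_⟩
  rw [Equiv.apply_symm_apply] at e
  have h1 : star U * U = 1 := (Unitary.mem_iff.1 hU).1
  have h2 : star V * V = 1 := (Unitary.mem_iff.1 hV).1
  rw [e, Matrix.mulVec_smul, Matrix.mulVec_mulVec, ← Matrix.mul_kronecker_mul, h1, h2,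
    Matrix.one_kronecker_one, Matrix.one_mulVec, smul_smul, inv_mul_cancel₀ hc0, one_smul]

theorem LUEquiv.trans {R S T : Set (Ket d)} : LUEquiv R S → LUEquiv S T → LUEquiv R T := by
  rintro ⟨U, hU, V, hV, π, h⟩ ⟨U', hU', V', hV', π', h'⟩
  refine ⟨U * U', mul_mem hU hU', V * V', mul_mem hV hV', π.trans π', fun M => ?_⟩
  obtain ⟨c, hc, e⟩ := h M
  obtain ⟨c', hc', e'⟩ := h' (π M)
  refine ⟨c * c', by simp [hc, hc'], ?_⟩
  rw [e, e', Equiv.trans_apply, Matrix.mulVec_smul, Matrix.mulVec_mulVec,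
    ← Matrix.mul_kronecker_mul, smul_smul]

end equivalence

/-- GPM-triples of the `d ⊗ d` system, with U-equivalence. -/
def GPMTriple (d : ℕ) [NeZero d] : Type := {T : Set (Mat d) // IsGPMTriple d T}

instance gpmSetoid (d : ℕ) [NeZero d] : Setoid (GPMTriple d) where
  r S T := UEquiv S.1 T.1
  iseqv := ⟨fun S => UEquiv.refl S.1, UEquiv.symm, UEquiv.trans⟩

/-- U-equivalence classes of GPM-triples. -/
abbrev GPMClass (d : ℕ) [NeZero d] : Type := Quotient (gpmSetoid d)

/-- The classes that contain a triple from the family `F`. -/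
def gpmClasses (d : ℕ) [NeZero d] (F : Set (Set (Mat d))) : Set (GPMClass d) :=
  (fun T : GPMTriple d => (⟦T⟧ : GPMClass d)) '' {T | T.1 ∈ F}

/-- GBS-triples of the `d ⊗ d` system, with LU-equivalence. -/
def GBSTriple (d : ℕ) [NeZero d] : Type := {T : Set (Ket d) // IsGBSTriple d T}

instance gbsSetoid (d : ℕ) [NeZero d] : Setoid (GBSTriple d) where
  r S T := LUEquiv S.1 T.1
  iseqv := ⟨fun S => LUEquiv.refl S.1, LUEquiv.symm, LUEquiv.trans⟩

/-- LU-equivalence classes of GBS-triples. -/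
abbrev GBSClass (d : ℕ) [NeZero d] : Type := Quotient (gbsSetoid d)

/-- The classes that contain a triple from the family `F`. -/
def gbsClasses (d : ℕ) [NeZero d] (F : Set (Set (Ket d))) : Set (GBSClass d) :=
  (fun T : GBSTriple d => (⟦T⟧ : GBSClass d)) '' {T | T.1 ∈ F}

/-- `[x]_d = {x, x⁻¹, 1-x, (1-x)⁻¹, 1-x⁻¹, x(x-1)⁻¹}`, where the elements that use an
inverse which does not exist in `ℤ/d` are omitted. -/
def sixClass {d : ℕ} (x : ZMod d) : Set (ZMod d) :=
  {y | y = x ∨ (IsUnit x ∧ y = x⁻¹) ∨ y = 1 - x ∨ (IsUnit (1 - x) ∧ y = (1 - x)⁻¹) ∨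
    (IsUnit x ∧ y = 1 - x⁻¹) ∨ (IsUnit (x - 1) ∧ y = x * (x - 1)⁻¹)}

/-- `[[x]]_d = {x, 1-x⁻¹, (1-x)⁻¹}`, with the same convention. -/
def threeClass {d : ℕ} (x : ZMod d) : Set (ZMod d) :=
  {y | y = x ∨ (IsUnit x ∧ y = 1 - x⁻¹) ∨ (IsUnit (1 - x) ∧ y = (1 - x)⁻¹)}

/-- `m` is the minimal element of `S ⊆ ℤ/d = {0, …, d-1}`. -/
def IsMinOf {d : ℕ} (S : Set (ZMod d)) (m : ℕ) : Prop := IsLeast (ZMod.val '' S) m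

/-- Parameters of the five families of representatives in the `p² ⊗ p²` system. -/
inductive RepIndex (p : ℕ) : Type
  | M (s : ℕ) (hs : 1 ≤ s ∧ s ≤ p ^ 2 / 2)
  | Nk (k m : ℕ) (hk : 1 ≤ k ∧ k ≤ (p - 1) / 2)
      (hm : ∃ s : ℕ, 2 ≤ s ∧ s ≤ p - 1 ∧ IsMinOf (threeClass (s : ZMod p)) m)
  | N (m : ℕ) (hm : ∃ s : ℕ, 2 ≤ s ∧ s < p ^ 2 ∧ IsMinOf (sixClass (s : ZMod (p ^ 2))) m)
  | M₀
  | W (m : ℕ) (hm : ∃ s : ℕ, 2 ≤ s ∧ s ≤ p - 1 ∧ IsMinOf (sixClass (s : ZMod p)) m)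

/-- The representing GPM-triples in the `p² ⊗ p²` system. -/
def rep (p : ℕ) [NeZero p] : RepIndex p → Set (Mat (p ^ 2))
  | .M s _ => {1, clockZ (p ^ 2), shiftX (p ^ 2) ^ s}
  | .Nk k m _ _ => {1, clockZ (p ^ 2), shiftX (p ^ 2) ^ (k * p) * clockZ (p ^ 2) ^ m}
  | .N m _ => {1, clockZ (p ^ 2), clockZ (p ^ 2) ^ m}
  | .M₀ => {1, clockZ (p ^ 2) ^ p, shiftX (p ^ 2) ^ p}
  | .W m _ => {1, clockZ (p ^ 2) ^ p, clockZ (p ^ 2) ^ (m * p)}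

/-- The corresponding GBS-triples. -/
def repKet (p : ℕ) [NeZero p] (i : RepIndex p) : Set (Ket (p ^ 2)) := toKet (p ^ 2) '' rep p i

/-- The five families of parameters. -/
def famM (p : ℕ) : Set (RepIndex p) := {i | ∃ s hs, i = .M s hs}

def famNk (p : ℕ) : Set (RepIndex p) := {i | ∃ k m hk hm, i = .Nk k m hk hm}

def famN (p : ℕ) : Set (RepIndex p) := {i | ∃ m hm, i = .N m hm}

def famM₀ (p : ℕ) : Set (RepIndex p) := {.M₀}

def famW (p : ℕ) : Set (RepIndex p) := {i | ∃ m hm, i = .W m hm}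

/-- `⌊5p²/6⌋ + ⌊(p-2)/6 + (-1)^⌊p/3⌋ p/3⌋ + 3`. -/
def tripleCount (p : ℕ) : ℤ :=
  ⌊(5 / 6 : ℚ) * (p : ℚ) ^ 2⌋ + ⌊((p : ℚ) - 2) / 6 + (-1) ^ (p / 3 : ℕ) * ((p : ℚ) / 3)⌋ + 3

end GenBell

end

/-! The GPMs are exactly the Weyl operators `weyl v` with labels `v` in `(ℤ/d)²`, so a GPM-triple is
a triple of distinct labels and U-equivalence becomes `TripleEquiv`.

Invariants. Eliminating the right-hand unitary shows that conjugation by a single unitary carries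
each `weyl (v i - v j)` to a multiple of `weyl (w i - w j)`. Since Weyl operators commute up to a
character of the symplectic form, the symplectic area of the triple is preserved, up to the sign of
the matching. So are the affine relations, i.e. the coefficients of sum zero that annihilate the
labels (`exists_invariants`, `tri_invariants`).

Existence. Translations, diagonal scalings, shears (2 is invertible) and the Fourier transform act
on labels through unitaries. With permutations they bring every triple to `tri q x y`, namely `0,
(0, q), (q x, q y)`, with `q = 1` or `q = p` (`exists_normalForm`). For `q = 1` and `x` a unit, a
shear kills `y`, giving `M`. For `x = p k ≠ 0` only `y` mod `p` matters: residues 0 and 1 again give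
`M`, while otherwise rotating the triple acts by `y ↦ 1 - y⁻¹` and a flip changes the sign of `k`,
giving `Nk`. For `x = 0` the points are collinear and `y` counts up to the six cross-ratio
substitutions, giving `N`. For `q = p` everything matters mod `p`; `x = 0` gives `W`, and the
triples with `x` a unit all collapse to `M₀` by a permutation of the basis that is not affine
(`tri_scale`).

Uniqueness (`repLabels_unique`). The area separates `M` and `Nk` from the rest and fixes `s` and `k`
up to sign; the affine relations do the remaining work.

Counting. On the `x` with `x` and `1 - x` invertible, the substitutions are an action of `S₃`,
respectively `A₃` for `threeClass`, and Burnside's lemma counts the orbits. The number of roots of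
`x² - x + 1` is at most two and is then forced by divisibility. In `ℤ/p²` the remaining parameters
contribute the minima `p κ`. The statements on states follow because `M ↦ (I ⊗ M)|φ₀₀⟩` is injective
and turns `A ⊗ B` into `M ↦ B M Aᵀ` (`lUEquiv_image_iff`). -/

open scoped Kronecker

noncomputable section

namespace GenBell

/-! ### Weyl operators and their labels. -/

section weyl

variable {d : ℕ}

/-- The matrix sending the basis vector `|j⟩` to `θ j |f j⟩`. -/
def monomialMat (f : ZMod d → ZMod d) (θ : ZMod d → ℂ) : Mat d :=
  Matrix.of fun i j => if i = f j then θ j else 0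

theorem monomialMat_apply (f : ZMod d → ZMod d) (θ : ZMod d → ℂ) (i j : ZMod d) :
    monomialMat f θ i j = if i = f j then θ j else 0 := rfl

variable [NeZero d]

theorem monomialMat_mul (f g : ZMod d → ZMod d) (θ η : ZMod d → ℂ) :
    monomialMat f θ * monomialMat g η = monomialMat (fun j => f (g j)) fun j => θ (g j) * η j := by
  ext i k
  simp [Matrix.mul_apply, monomialMat_apply]

theorem monomialMat_mem_unitary (f : ZMod d → ZMod d) (hf : Function.Injective f)
    (θ : ZMod d → ℂ) (hθ : ∀ j, ‖θ j‖ = 1) :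
    monomialMat f θ ∈ Matrix.unitaryGroup (ZMod d) ℂ := by
  rw [Matrix.mem_unitaryGroup_iff']
  ext i k
  rw [Matrix.mul_apply]
  simp only [Matrix.star_apply, monomialMat_apply, apply_ite star, star_zero, ite_mul, zero_mul,
    mul_ite, mul_zero]
  rcases eq_or_ne i k with rfl | h
  · have := hθ i
    simp [Complex.conj_mul', this]
  · rw [Matrix.one_apply_ne h]
    refine Finset.sum_eq_zero fun j _ => ?_
    split_ifs with h1 h2
    · exact absurd (hf (h1.symm.trans h2)) h.symm
    all_goals rfl

/-- The additive character `x ↦ ω ^ x` of `ℤ/d`. -/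
abbrev chi (x : ZMod d) : ℂ := ZMod.stdAddChar x

theorem norm_chi (x : ZMod d) : ‖chi x‖ = 1 := AddChar.norm_apply _ _

theorem chi_add (x y : ZMod d) : chi (x + y) = chi x * chi y := AddChar.map_add_eq_mul _ _ _

/-- The Weyl operator `X^{v.1} Z^{v.2}`. -/
def weyl (v : ZMod d × ZMod d) : Mat d :=
  monomialMat (fun j => j + v.1) fun j => chi (v.2 * j)

theorem weyl_mul (v w : ZMod d × ZMod d) : weyl v * weyl w = chi (v.2 * w.1) • weyl (v + w) := by
  rw [weyl, weyl, monomialMat_mul]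
  ext i j
  simp only [Matrix.smul_apply, weyl, monomialMat_apply, Prod.fst_add, Prod.snd_add, smul_eq_mul,
    mul_ite, mul_zero, ← chi_add]
  congr 1
  · rw [add_assoc, add_comm w.1]
  · congr 1; ring

theorem weyl_zero : weyl (0 : ZMod d × ZMod d) = 1 := by
  ext i j
  simp [weyl, monomialMat_apply, Matrix.one_apply, chi]

theorem weyl_mem_unitary (v : ZMod d × ZMod d) : weyl v ∈ Matrix.unitaryGroup (ZMod d) ℂ :=
  monomialMat_mem_unitary _ (add_left_injective _) _ fun _ => norm_chi _

theorem clockZ_eq : clockZ d = weyl (0, 1) := by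
  ext i j
  have : Complex.exp (2 * Real.pi * Complex.I / d) ^ j.val = chi j := by
    rw [← Complex.exp_nat_mul]
    have h := ZMod.stdAddChar_coe (N := d) (j.val : ℤ)
    simp only [Int.cast_natCast, ZMod.natCast_zmod_val] at h
    rw [chi, h]; congr 1; ring
  rcases eq_or_ne i j with rfl | h
  · simp [clockZ, weyl, monomialMat_apply, this]
  · simp [clockZ, weyl, monomialMat_apply, h]

theorem shiftX_eq : shiftX d = weyl (1, 0) := by
  ext i j
  simp [shiftX, weyl, monomialMat_apply, chi]

theorem clockZ_pow (t : ℕ) : clockZ d ^ t = weyl (0, (t : ZMod d)) := by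
  induction t with
  | zero => rw [pow_zero, Nat.cast_zero]; exact weyl_zero.symm
  | succ n ih => rw [pow_succ, ih, clockZ_eq, weyl_mul]; simp [chi]

theorem shiftX_pow (s : ℕ) : shiftX d ^ s = weyl ((s : ZMod d), 0) := by
  induction s with
  | zero => rw [pow_zero, Nat.cast_zero]; exact weyl_zero.symm
  | succ n ih => rw [pow_succ, ih, shiftX_eq, weyl_mul]; simp [chi]

theorem shiftX_pow_mul_clockZ_pow (s t : ℕ) :
    shiftX d ^ s * clockZ d ^ t = weyl ((s : ZMod d), (t : ZMod d)) := by
  rw [shiftX_pow, clockZ_pow, weyl_mul]; simp [chi]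

theorem isGPM_iff (M : Mat d) : IsGPM d M ↔ ∃ v, M = weyl v := by
  constructor
  · rintro ⟨s, t, -, -, rfl⟩
    exact ⟨_, shiftX_pow_mul_clockZ_pow s t⟩
  · rintro ⟨v, rfl⟩
    refine ⟨v.1.val, v.2.val, ZMod.val_lt _, ZMod.val_lt _, ?_⟩
    rw [shiftX_pow_mul_clockZ_pow]; simp

/-- Column 0 forces equal shifts and `c = 1`; column 1 then compares the values of a faithful
character. -/
theorem eq_of_weyl_eq_smul {v w : ZMod d × ZMod d} {c : ℂ} (h : weyl v = c • weyl w) :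
    v = w := by
  have key (j : ZMod d) := congrFun (congrFun h (j + v.1)) j
  simp only [weyl, monomialMat_apply, if_true, Matrix.smul_apply, smul_eq_mul, mul_ite,
    mul_zero, add_right_inj] at key
  have h0 := key 0
  have h1 := key 1
  by_cases hv : v.1 = w.1
  · simp only [hv, if_true, mul_zero, mul_one, chi, AddChar.map_zero_eq_one] at h0 h1
    rw [← h0, one_mul] at h1
    exact Prod.ext hv (ZMod.injective_stdAddChar h1)
  · simp [hv, chi] at h0

theorem weyl_injective : Function.Injective (weyl : ZMod d × ZMod d → Mat d) := fun v w h =>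
  eq_of_weyl_eq_smul (c := 1) (by rw [one_smul, h])

end weyl

/-! ### Unitary gates acting on labels, and the invariants of conjugation. -/

section projEquiv

variable {d : ℕ} [NeZero d] {ι κ : Type*}

/-- The families `weyl ∘ v` and `weyl ∘ w` agree up to multiplication by fixed unitaries on the left
and on the right, and up to phases. -/
def ProjEquiv (v w : ι → ZMod d × ZMod d) : Prop :=
  ∃ U ∈ Matrix.unitaryGroup (ZMod d) ℂ, ∃ V ∈ Matrix.unitaryGroup (ZMod d) ℂ,
    ∀ i, ∃ c : ℂ, ‖c‖ = 1 ∧ U * weyl (v i) = c • (weyl (w i) * V)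

namespace ProjEquiv

theorem refl (v : ι → ZMod d × ZMod d) : ProjEquiv v v :=
  ⟨1, one_mem _, 1, one_mem _, fun _ => ⟨1, by simp, by simp⟩⟩

theorem trans {u v w : ι → ZMod d × ZMod d} (h : ProjEquiv u v) (h' : ProjEquiv v w) :
    ProjEquiv u w := by
  obtain ⟨U, hU, V, hV, e⟩ := h
  obtain ⟨U', hU', V', hV', e'⟩ := h'
  refine ⟨U' * U, mul_mem hU' hU, V' * V, mul_mem hV' hV, fun i => ?_⟩
  obtain ⟨c, hc, e⟩ := e i
  obtain ⟨c', hc', e'⟩ := e' i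
  refine ⟨c * c', by simp [hc, hc'], ?_⟩
  rw [mul_assoc, e, mul_smul_comm, ← mul_assoc, e', smul_mul_assoc, smul_smul, mul_assoc]

theorem symm {v w : ι → ZMod d × ZMod d} (h : ProjEquiv v w) : ProjEquiv w v := by
  obtain ⟨U, hU, V, hV, e⟩ := h
  refine ⟨star U, Unitary.star_mem hU, star V, Unitary.star_mem hV, fun i => ?_⟩
  obtain ⟨c, hc, e⟩ := e i
  have hc0 : c ≠ 0 := by rintro rfl; simp at hc
  refine ⟨c⁻¹, by simp [hc], ?_⟩
  have h1 : star U * U = 1 := (Unitary.mem_iff.1 hU).1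
  have h2 : V * star V = 1 := (Unitary.mem_iff.1 hV).2
  have : weyl (w i) = c⁻¹ • (U * weyl (v i) * star V) := by
    rw [e, smul_mul_assoc, smul_smul, inv_mul_cancel₀ hc0, one_smul, mul_assoc, h2, mul_one]
  rw [this, mul_smul_comm, ← mul_assoc, ← mul_assoc, h1, one_mul]

theorem comp {v w : ι → ZMod d × ZMod d} (h : ProjEquiv v w) (f : κ → ι) :
    ProjEquiv (fun k => v (f k)) (fun k => w (f k)) := by
  obtain ⟨U, hU, V, hV, e⟩ := h
  exact ⟨U, hU, V, hV, fun k => e (f k)⟩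

theorem add_const (v : ι → ZMod d × ZMod d) (t : ZMod d × ZMod d) :
    ProjEquiv v (fun i => v i + t) := by
  refine ⟨weyl t, weyl_mem_unitary t, 1, one_mem _, fun i => ⟨chi (t.2 * (v i).1), norm_chi _, ?_⟩⟩
  rw [weyl_mul, mul_one, add_comm]

/-- One monomial matrix serves on both sides: `h1` matches the supports and `h2` the phases. The map
`f` need not be affine, which `tri_scale` exploits. -/
theorem monomial {v w : ι → ZMod d × ZMod d} (f : ZMod d → ZMod d) (hf : Function.Injective f)
    (θ : ZMod d → ℂ) (hθ : ∀ j, ‖θ j‖ = 1) (h1 : ∀ i j, f (j + (v i).1) = f j + (w i).1)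
    (c : ι → ℂ) (hc : ∀ i, ‖c i‖ = 1)
    (h2 : ∀ i j, θ (j + (v i).1) * chi ((v i).2 * j) = c i * (chi ((w i).2 * f j) * θ j)) :
    ProjEquiv v w := by
  have hu := monomialMat_mem_unitary f hf θ hθ
  refine ⟨_, hu, _, hu, fun i => ⟨c i, hc i, ?_⟩⟩
  rw [weyl, weyl, monomialMat_mul, monomialMat_mul]
  ext a b
  simp only [Matrix.smul_apply, monomialMat_apply, h1, h2, smul_eq_mul, mul_ite, mul_zero]

theorem mul_unit (v : ι → ZMod d × ZMod d) {u u' : ZMod d} (hu : u * u' = 1) :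
    ProjEquiv v (fun i => (u * (v i).1, u' * (v i).2)) := by
  refine monomial (fun j => u * j) (fun a b h => ?_) (fun _ => 1) (by simp) (fun i j => mul_add _ _ _)
    (fun _ => 1) (by simp) (fun i j => ?_)
  · have := congrArg (u' * ·) h
    simpa [← mul_assoc, mul_comm u' u, hu] using this
  · simp only [one_mul, mul_one]
    congr 1
    linear_combination -(v i).2 * j * hu

/-- Implemented by the quadratic phase `j ↦ χ(c j² / 2)`, which is why 2 must be invertible: the
cross term of `(j + v.1)²` is the desired linear character. -/
theorem shear_snd (hd : IsUnit (2 : ZMod d)) (v : ι → ZMod d × ZMod d) (c : ZMod d) :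
    ProjEquiv v (fun i => ((v i).1, (v i).2 + c * (v i).1)) := by
  obtain ⟨h, hh⟩ := hd.exists_right_inv
  refine monomial id Function.injective_id (fun j => chi (c * h * j ^ 2)) (fun _ => norm_chi _)
    (fun _ _ => rfl) (fun i => chi (c * h * (v i).1 ^ 2)) (fun _ => norm_chi _) (fun i j => ?_)
  simp only [← chi_add]
  congr 1
  simp only [id]
  linear_combination j * c * (v i).1 * hh

/-- The discrete Fourier transform. -/
def fourierMat (d : ℕ) [NeZero d] : Mat d :=
  Matrix.of fun i j => ((Real.sqrt d : ℝ) : ℂ)⁻¹ * chi (i * j)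

theorem fourierMat_mem_unitary : fourierMat d ∈ Matrix.unitaryGroup (ZMod d) ℂ := by
  rw [Matrix.mem_unitaryGroup_iff]
  ext i k
  have hs : ((Real.sqrt d : ℝ) : ℂ)⁻¹ * ((Real.sqrt d : ℝ) : ℂ)⁻¹ = (d : ℂ)⁻¹ := by
    rw [← mul_inv, ← Complex.ofReal_mul, Real.mul_self_sqrt (Nat.cast_nonneg d),
      Complex.ofReal_natCast]
  have hterm (j : ZMod d) : fourierMat d i j * star (fourierMat d) j k
      = (d : ℂ)⁻¹ * ZMod.stdAddChar (j * (i - k)) := by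
    rw [Matrix.star_apply, fourierMat, Matrix.of_apply, Matrix.of_apply, star_mul', ← hs]
    have h1 : star (chi (k * j)) = chi (-(k * j)) := (AddChar.map_neg_eq_conj _ _).symm
    have h2 : star (((Real.sqrt d : ℝ) : ℂ)⁻¹) = ((Real.sqrt d : ℝ) : ℂ)⁻¹ := by
      rw [star_inv₀]; congr 1; exact Complex.conj_ofReal _
    have h3 : j * (i - k) = i * j + -(k * j) := by ring
    rw [h1, h2, h3, AddChar.map_add_eq_mul]
    ring
  rw [Matrix.mul_apply, Finset.sum_congr rfl fun j _ => hterm j, ← Finset.mul_sum,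
    AddChar.sum_mulShift (i - k) (ZMod.isPrimitive_stdAddChar d)]
  have : (d : ℂ) ≠ 0 := NeZero.ne _
  rcases eq_or_ne i k with rfl | h
  · simp [this]
  · simp [h, sub_eq_zero]

theorem fourier (v : ι → ZMod d × ZMod d) : ProjEquiv v (fun i => (-(v i).2, (v i).1)) := by
  refine ⟨_, fourierMat_mem_unitary, _, fourierMat_mem_unitary, fun i =>
    ⟨chi (-((v i).1 * (v i).2)), norm_chi _, ?_⟩⟩
  ext a b
  rw [Matrix.smul_apply, Matrix.mul_apply, Matrix.mul_apply]
  simp only [weyl, monomialMat_apply, fourierMat, Matrix.of_apply, mul_ite, mul_zero, ite_mul,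
    zero_mul, smul_eq_mul]
  rw [Finset.sum_ite_eq' Finset.univ, if_pos (Finset.mem_univ _)]
  have : ∀ x : ZMod d, (a = x + -(v i).2) ↔ (x = a + (v i).2) := fun x =>
    ⟨fun h => by rw [h]; ring, fun h => by rw [h]; ring⟩
  simp only [this]
  rw [Finset.sum_ite_eq' Finset.univ, if_pos (Finset.mem_univ _)]
  have e : chi (a * (b + (v i).1)) * chi ((v i).2 * b) = chi (-((v i).1 * (v i).2)) *
      (chi ((v i).1 * (a + (v i).2)) * chi ((a + (v i).2) * b)) := by
    simp only [← chi_add]; congr 1; ring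
  linear_combination ((Real.sqrt d : ℝ) : ℂ)⁻¹ * e

/-- The Fourier transform exchanges the two coordinates, so this is a conjugate of `shear_snd`; two
Fourier transforms negate the label, and the final scaling by `-1` undoes that. -/
theorem shear_fst (hd : IsUnit (2 : ZMod d)) (v : ι → ZMod d × ZMod d) (c : ZMod d) :
    ProjEquiv v (fun i => ((v i).1 + c * (v i).2, (v i).2)) := by
  have := ((fourier v).trans (shear_snd hd _ (-c))).trans (fourier _).symm.symm
  refine this.trans ?_
  have h := mul_unit (fun i => (-((v i).1 + c * (v i).2), -(v i).2)) (u := (-1 : ZMod d)) (u' := -1)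
    (by ring)
  simpa using h

end ProjEquiv

/-- The symplectic form on `(ℤ/d)²`. -/
def sympl (a b : ZMod d × ZMod d) : ZMod d := a.2 * b.1 - a.1 * b.2

/-- The pairs `(a, b)` for which conjugation by `U` takes `weyl a` to a multiple of `weyl b`. -/
def conjPairs (U : Mat d) : AddSubmonoid ((ZMod d × ZMod d) × (ZMod d × ZMod d)) where
  carrier := {q | ∃ c : ℂ, c ≠ 0 ∧ U * weyl q.1 = c • (weyl q.2 * U)}
  zero_mem' := ⟨1, one_ne_zero, by simp [weyl_zero]⟩
  add_mem' := by
    rintro ⟨a, b⟩ ⟨a', b'⟩ ⟨c, hc, h⟩ ⟨c', hc', h'⟩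
    have hn (x : ZMod d) : chi x ≠ 0 := by
      intro e; have := norm_chi x; rw [e] at this; simp at this
    refine ⟨(chi (a.2 * a'.1))⁻¹ * (c * c' * chi (b.2 * b'.1)), by simp [hn, hc, hc'], ?_⟩
    have e1 : weyl (a + a') = (chi (a.2 * a'.1))⁻¹ • (weyl a * weyl a') := by
      rw [weyl_mul, smul_smul, inv_mul_cancel₀ (hn _), one_smul]
    simp only at h h' ⊢
    rw [Prod.mk_add_mk, e1, mul_smul_comm, ← mul_assoc, h, smul_mul_assoc, mul_assoc, h',
      mul_smul_comm, ← mul_assoc, weyl_mul, smul_mul_assoc]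
    simp only [smul_smul]
    congr 1
    ring

theorem smul_mem_conjPairs {U : Mat d} {q} (h : q ∈ conjPairs U) (c : ZMod d) :
    c • q ∈ conjPairs U := by
  have : c • q = c.val • q := by
    rw [← Nat.cast_smul_eq_nsmul (ZMod d), ZMod.natCast_zmod_val]
  rw [this]
  exact nsmul_mem h _

/-- If the conjugate of `weyl a` is a scalar then so is `weyl a`, and only the zero label gives a
scalar. -/
theorem eq_zero_of_mem_conjPairs {U : Mat d} (hU : U ∈ Matrix.unitaryGroup (ZMod d) ℂ)
    {a : ZMod d × ZMod d} (h : (a, 0) ∈ conjPairs U) : a = 0 := by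
  obtain ⟨c, -, e⟩ := h
  simp only [weyl_zero, one_mul] at e
  have h1 : star U * U = 1 := (Unitary.mem_iff.1 hU).1
  refine eq_of_weyl_eq_smul (c := c) ?_
  rw [weyl_zero, ← h1, ← mul_smul_comm, ← e, ← mul_assoc, h1, one_mul]

/-- Two Weyl operators commute up to the character of the symplectic form of their labels, and
conjugation preserves this commutation phase; the character is injective. -/
theorem sympl_eq_of_mem_conjPairs {U : Mat d} (hU : U ∈ Matrix.unitaryGroup (ZMod d) ℂ)
    {q r : (ZMod d × ZMod d) × (ZMod d × ZMod d)} (hq : q ∈ conjPairs U) (hr : r ∈ conjPairs U) :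
    sympl q.1 r.1 = sympl q.2 r.2 := by
  have comm (a b : ZMod d × ZMod d) : weyl a * weyl b = chi (sympl a b) • (weyl b * weyl a) := by
    rw [weyl_mul, weyl_mul, smul_smul, ← chi_add, add_comm b a, sympl]
    congr 2; ring
  obtain ⟨c, hc, e⟩ := hq
  obtain ⟨c', hc', e'⟩ := hr
  have h1 : U * star U = 1 := (Unitary.mem_iff.1 hU).2
  have A : U * (weyl q.1 * weyl r.1) = (c * c') • (weyl q.2 * weyl r.2 * U) := by
    rw [← mul_assoc, e, smul_mul_assoc, mul_assoc, e', mul_smul_comm, smul_smul, ← mul_assoc]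
  have B : U * (weyl r.1 * weyl q.1) = (c * c') • (weyl r.2 * weyl q.2 * U) := by
    rw [← mul_assoc, e', smul_mul_assoc, mul_assoc, e, mul_smul_comm, smul_smul, ← mul_assoc,
      mul_comm c']
  rw [comm, mul_smul_comm, B, comm q.2, smul_mul_assoc, smul_smul, smul_smul] at A
  have A' := congrArg (· * (star U * star (weyl q.2) * star (weyl r.2))) A
  have h2 : weyl r.2 * weyl q.2 * U * (star U * star (weyl q.2) * star (weyl r.2)) = 1 := by
    have hq2 : weyl q.2 * star (weyl q.2) = 1 := (Unitary.mem_iff.1 (weyl_mem_unitary _)).2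
    have hr2 : weyl r.2 * star (weyl r.2) = 1 := (Unitary.mem_iff.1 (weyl_mem_unitary _)).2
    calc _ = weyl r.2 * (weyl q.2 * (U * star U) * star (weyl q.2)) * star (weyl r.2) := by
          simp only [mul_assoc]
      _ = 1 := by rw [h1, mul_one, hq2, mul_one, hr2]
  simp only [smul_mul_assoc, h2] at A'
  have A'' := congrFun (congrFun A' 0) 0
  simp only [Matrix.smul_apply, Matrix.one_apply_eq, smul_eq_mul, mul_one] at A''
  rw [mul_comm (c * c')] at A''
  exact ZMod.injective_stdAddChar (mul_right_cancel₀ (mul_ne_zero hc hc') A'')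

/-- From `U W(vᵢ) ∝ W(wᵢ) V` for two indices, dividing one equation by the other removes `V` and
leaves conjugation by `U` on the difference labels. -/
theorem ProjEquiv.exists_conjPairs {v w : ι → ZMod d × ZMod d} (h : ProjEquiv v w) :
    ∃ U ∈ Matrix.unitaryGroup (ZMod d) ℂ, ∀ i j, (v i - v j, w i - w j) ∈ conjPairs U := by
  obtain ⟨U, hU, V, hV, e⟩ := h
  refine ⟨U, hU, fun i j => ?_⟩
  obtain ⟨c, hc, e1⟩ := e i
  obtain ⟨c', hc', e2⟩ := e j
  have hc0 : c ≠ 0 := by rintro rfl; simp at hc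
  have hc0' : c' ≠ 0 := by rintro rfl; simp at hc'
  have hn (x : ZMod d) : chi x ≠ 0 := by
    intro e; have := norm_chi x; rw [e] at this; simp at this
  have f1 : U * weyl (v i - v j) * weyl (v j)
      = chi ((v i - v j).2 * (v j).1) • (c • (weyl (w i) * V)) := by
    rw [mul_assoc, weyl_mul, sub_add_cancel, mul_smul_comm, e1]
  have f2 : weyl (w i) = (chi ((w i - w j).2 * (w j).1))⁻¹ • (weyl (w i - w j) * weyl (w j)) := by
    rw [weyl_mul, sub_add_cancel, smul_smul, inv_mul_cancel₀ (hn _), one_smul]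
  have f3 : weyl (w j) * V = c'⁻¹ • (U * weyl (v j)) := by
    rw [e2, smul_smul, inv_mul_cancel₀ hc0', one_smul]
  have hv : weyl (v j) * star (weyl (v j)) = 1 := (Unitary.mem_iff.1 (weyl_mem_unitary _)).2
  refine ⟨chi ((v i - v j).2 * (v j).1) * (c * ((chi ((w i - w j).2 * (w j).1))⁻¹ * c'⁻¹)),
    by simp [hn, hc0, hc0'], ?_⟩
  rw [f2, smul_mul_assoc, mul_assoc (weyl (w i - w j)), f3, mul_smul_comm,
    ← mul_assoc (weyl (w i - w j))] at f1
  have := congrArg (· * star (weyl (v j))) f1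
  simp only [smul_mul_assoc, mul_assoc, hv, mul_one] at this
  rw [this]
  simp only [smul_smul]

end projEquiv

/-! ### Triples of labels and their correspondence with GPM-triples. -/

section triples

variable {d : ℕ} [NeZero d]

/-- Projective equivalence of triples of labels, up to a permutation. -/
def TripleEquiv (v w : Fin 3 → ZMod d × ZMod d) : Prop :=
  ∃ τ : Equiv.Perm (Fin 3), ProjEquiv v (fun i => w (τ i))

theorem ProjEquiv.tripleEquiv {v w : Fin 3 → ZMod d × ZMod d} (h : ProjEquiv v w) :
    TripleEquiv v w := ⟨1, h⟩

namespace TripleEquiv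

theorem refl (v : Fin 3 → ZMod d × ZMod d) : TripleEquiv v v := (ProjEquiv.refl v).tripleEquiv

theorem symm {v w : Fin 3 → ZMod d × ZMod d} (h : TripleEquiv v w) : TripleEquiv w v := by
  obtain ⟨τ, h⟩ := h
  exact ⟨τ⁻¹, by simpa using h.symm.comp (τ⁻¹ : Equiv.Perm (Fin 3))⟩

theorem trans {u v w : Fin 3 → ZMod d × ZMod d} (h : TripleEquiv u v) (h' : TripleEquiv v w) :
    TripleEquiv u w := by
  obtain ⟨τ, h⟩ := h
  obtain ⟨τ', h'⟩ := h'
  exact ⟨τ' * τ, h.trans (h'.comp τ)⟩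

theorem perm (w : Fin 3 → ZMod d × ZMod d) (τ : Equiv.Perm (Fin 3)) :
    TripleEquiv (fun i => w (τ i)) w := ⟨τ, ProjEquiv.refl _⟩

theorem swap₀₁ (a b c : ZMod d × ZMod d) : TripleEquiv ![a, b, c] ![b, a, c] := by
  have h : (fun i => ![b, a, c] (Equiv.swap 0 1 i)) = ![a, b, c] := by
    funext i; fin_cases i <;> rfl
  exact h ▸ perm _ _

theorem swap₀₂ (a b c : ZMod d × ZMod d) : TripleEquiv ![a, b, c] ![c, b, a] := by
  have h : (fun i => ![c, b, a] (Equiv.swap 0 2 i)) = ![a, b, c] := by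
    funext i; fin_cases i <;> rfl
  exact h ▸ perm _ _

theorem swap₁₂ (a b c : ZMod d × ZMod d) : TripleEquiv ![a, b, c] ![a, c, b] := by
  have h : (fun i => ![a, c, b] (Equiv.swap 1 2 i)) = ![a, b, c] := by
    funext i; fin_cases i <;> rfl
  exact h ▸ perm _ _

/-- Apply a label transformation that is implemented by a projective equivalence. -/
theorem map {g : ZMod d × ZMod d → ZMod d × ZMod d} (hg : ProjEquiv (fun v => v) g)
    (a b c : ZMod d × ZMod d) : TripleEquiv ![a, b, c] ![g a, g b, g c] := by
  refine ProjEquiv.tripleEquiv ?_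
  convert hg.comp ![a, b, c] using 1
  funext i; fin_cases i <;> rfl

theorem map_eq {g : ZMod d × ZMod d → ZMod d × ZMod d} (hg : ProjEquiv (fun v => v) g)
    {a b c a' b' c' : ZMod d × ZMod d} (ha : g a = a') (hb : g b = b') (hc : g c = c') :
    TripleEquiv ![a, b, c] ![a', b', c'] := by
  subst ha hb hc
  exact map hg a b c

/-- The symplectic area and the linear relations are invariants. -/
theorem exists_invariants {v w : Fin 3 → ZMod d × ZMod d} (h : TripleEquiv v w) :
    ∃ τ : Equiv.Perm (Fin 3),
      sympl (v 1 - v 0) (v 2 - v 0) = sympl (w (τ 1) - w (τ 0)) (w (τ 2) - w (τ 0)) ∧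
      ∀ c₀ c₁ c₂ : ZMod d, c₀ + c₁ + c₂ = 0 →
        c₀ • w (τ 0) + c₁ • w (τ 1) + c₂ • w (τ 2) = 0 → c₀ • v 0 + c₁ • v 1 + c₂ • v 2 = 0 := by
  obtain ⟨τ, h⟩ := h
  obtain ⟨U, hU, hp⟩ := h.exists_conjPairs
  refine ⟨τ, sympl_eq_of_mem_conjPairs hU (hp 1 0) (hp 2 0), fun c₀ c₁ c₂ hc hw => ?_⟩
  -- Coefficients of sum zero rewrite the combination in terms of differences from the point 0, to
  -- which `conjPairs` applies.
  have hc₀ : c₀ = -(c₁ + c₂) := by linear_combination hc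
  have := add_mem (smul_mem_conjPairs (hp 1 0) c₁) (smul_mem_conjPairs (hp 2 0) c₂)
  simp only [Prod.smul_mk, Prod.mk_add_mk] at this
  have e (x y z : ZMod d × ZMod d) :
      c₁ • (y - x) + c₂ • (z - x) = c₀ • x + c₁ • y + c₂ • z := by
    rw [hc₀]; module
  rw [e, e, hw] at this
  exact eq_zero_of_mem_conjPairs hU this

end TripleEquiv

theorem isGPMTriple_range {v : Fin 3 → ZMod d × ZMod d} (hv : Function.Injective v) :
    IsGPMTriple d (Set.range fun i => weyl (v i)) := by
  constructor
  · have hi : Function.Injective fun i => weyl (v i) := weyl_injective.comp hv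
    rw [← Set.image_univ, Set.ncard_image_of_injective _ hi]
    simp
  · rintro _ ⟨i, rfl⟩
    exact (isGPM_iff _).2 ⟨_, rfl⟩

theorem IsGPMTriple.exists_range {T : Set (Mat d)} (h : IsGPMTriple d T) :
    ∃ v : Fin 3 → ZMod d × ZMod d, Function.Injective v ∧ T = Set.range fun i => weyl (v i) := by
  obtain ⟨h3, hT⟩ := h
  obtain ⟨A, B, C, hAB, hAC, hBC, rfl⟩ := Set.ncard_eq_three.1 h3
  obtain ⟨a, rfl⟩ := (isGPM_iff _).1 (hT A (by simp))
  obtain ⟨b, rfl⟩ := (isGPM_iff _).1 (hT B (by simp))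
  obtain ⟨c, rfl⟩ := (isGPM_iff _).1 (hT C (by simp))
  replace hAB : a ≠ b := fun h => hAB (congrArg weyl h)
  replace hAC : a ≠ c := fun h => hAC (congrArg weyl h)
  replace hBC : b ≠ c := fun h => hBC (congrArg weyl h)
  refine ⟨![a, b, c], ?_, ?_⟩
  · intro i j
    fin_cases i <;> fin_cases j <;> simp [hAB, hAC, hBC, hAB.symm, hAC.symm, hBC.symm]
  · ext M
    simp [Set.mem_range, Fin.exists_fin_succ, eq_comm]

/-- Only a change of convention: `M = c U (π M) V` is rewritten as `U⁻¹ M = c (π M) V`. -/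
theorem uEquiv_range_iff {v w : Fin 3 → ZMod d × ZMod d} (hv : Function.Injective v)
    (hw : Function.Injective w) :
    UEquiv (Set.range fun i => weyl (v i)) (Set.range fun i => weyl (w i)) ↔ TripleEquiv v w := by
  have hv' : Function.Injective fun i => weyl (v i) := weyl_injective.comp hv
  have hw' : Function.Injective fun i => weyl (w i) := weyl_injective.comp hw
  set ev := Equiv.ofInjective _ hv'
  set ew := Equiv.ofInjective _ hw'
  constructor
  · rintro ⟨U, hU, V, hV, π, h⟩
    refine ⟨(ev.trans π).trans ew.symm, star U, Unitary.star_mem hU, V, hV, fun i => ?_⟩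
    obtain ⟨c, hc, e⟩ := h (ev i)
    refine ⟨c, hc, ?_⟩
    have h1 : star U * U = 1 := (Unitary.mem_iff.1 hU).1
    have h2 : weyl (w (((ev.trans π).trans ew.symm) i)) = (π (ev i) : Mat d) :=
      congrArg Subtype.val (ew.apply_symm_apply (π (ev i)))
    have h3 : (ev i : Mat d) = weyl (v i) := rfl
    rw [h2, ← h3, e, mul_smul_comm, mul_assoc, ← mul_assoc, h1, one_mul]
  · rintro ⟨τ, U, hU, V, hV, h⟩
    refine ⟨star U, Unitary.star_mem hU, V, hV, (ev.symm.trans τ).trans ew, fun M => ?_⟩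
    obtain ⟨i, rfl⟩ := ev.surjective M
    obtain ⟨c, hc, e⟩ := h i
    refine ⟨c, hc, ?_⟩
    have h1 : star U * U = 1 := (Unitary.mem_iff.1 hU).1
    have h2 : ((((ev.symm.trans τ).trans ew) (ev i) : _) : Mat d) = weyl (w (τ i)) := by
      simp [ew]
    have h3 : (ev i : Mat d) = weyl (v i) := rfl
    rw [h2, h3, mul_assoc, ← mul_smul_comm, ← e, ← mul_assoc, h1, one_mul]

end triples

/-! ### Transfer from matrices to states. -/

section kets

variable {d : ℕ} [NeZero d]

theorem toKet_apply (M : Mat d) (x : ZMod d × ZMod d) :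
    toKet d M x = ((Real.sqrt d : ℝ) : ℂ)⁻¹ * M x.2 x.1 := by
  rw [toKet, Matrix.mulVec, dotProduct, Fintype.sum_prod_type]
  simp [Matrix.kroneckerMap_apply, stdMES, Matrix.one_apply, mul_comm]

theorem sqrt_ne_zero : ((Real.sqrt d : ℝ) : ℂ) ≠ 0 := by
  have : (0 : ℝ) < d := Nat.cast_pos.2 (NeZero.pos d)
  exact Complex.ofReal_ne_zero.2 (Real.sqrt_pos.2 this).ne'

theorem toKet_injective : Function.Injective (toKet d) := by
  intro M N h
  ext i j
  have := congrFun h (j, i)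
  rw [toKet_apply, toKet_apply] at this
  exact mul_left_cancel₀ (inv_ne_zero sqrt_ne_zero) this

theorem toKet_smul (c : ℂ) (M : Mat d) : toKet d (c • M) = c • toKet d M := by
  ext x
  simp only [toKet_apply, Matrix.smul_apply, Pi.smul_apply, smul_eq_mul]
  ring

/-- The state of `M` is `M` reshaped into a vector, so this is the usual vectorization identity; it
turns local unitaries into left and right multiplication. -/
theorem kronecker_mulVec_toKet (A B M : Mat d) :
    (A ⊗ₖ B).mulVec (toKet d M) = toKet d (B * M * A.transpose) := by
  ext x
  rw [toKet_apply, Matrix.mulVec, dotProduct, Fintype.sum_prod_type, Matrix.mul_apply,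
    Finset.mul_sum]
  refine Finset.sum_congr rfl fun i _ => ?_
  rw [Matrix.mul_apply, Finset.sum_mul, Finset.mul_sum]
  refine Finset.sum_congr rfl fun j _ => ?_
  rw [toKet_apply, Matrix.kroneckerMap_apply, Matrix.transpose_apply]
  ring

theorem transpose_mem_unitary {U : Mat d} (hU : U ∈ Matrix.unitaryGroup (ZMod d) ℂ) :
    U.transpose ∈ Matrix.unitaryGroup (ZMod d) ℂ := by
  rw [Matrix.mem_unitaryGroup_iff'] at *
  have := congrArg Matrix.transpose (mul_eq_one_comm.1 hU)
  rw [Matrix.transpose_mul, Matrix.transpose_one] at this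
  exact this

theorem lUEquiv_image_iff (S T : Set (Mat d)) :
    LUEquiv (toKet d '' S) (toKet d '' T) ↔ UEquiv S T := by
  set eS := Equiv.Set.image (toKet d) S toKet_injective
  set eT := Equiv.Set.image (toKet d) T toKet_injective
  have hS (M : S) : ((eS M : _) : Ket d) = toKet d M := rfl
  have hT (M : T) : ((eT M : _) : Ket d) = toKet d M := rfl
  constructor
  · rintro ⟨A, hA, B, hB, π, h⟩
    refine ⟨B, hB, A.transpose, transpose_mem_unitary hA, (eS.trans π).trans eT.symm, fun M => ?_⟩
    obtain ⟨c, hc, e⟩ := h (eS M)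
    refine ⟨c, hc, toKet_injective ?_⟩
    rw [toKet_smul, ← kronecker_mulVec_toKet, ← hS, e, ← hT]
    simp
  · rintro ⟨A, hA, B, hB, π, h⟩
    refine ⟨B.transpose, transpose_mem_unitary hB, A, hA, (eS.symm.trans π).trans eT, fun φ => ?_⟩
    obtain ⟨M, rfl⟩ := eS.surjective φ
    obtain ⟨c, hc, e⟩ := h M
    refine ⟨c, hc, ?_⟩
    have : (((eS.symm.trans π).trans eT) (eS M) : Ket d) = toKet d (π M) := by simp [hT]
    rw [this, hS, e, toKet_smul, kronecker_mulVec_toKet, Matrix.transpose_transpose]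

theorem isGBSTriple_image_iff (T : Set (Mat d)) :
    IsGBSTriple d (toKet d '' T) ↔ IsGPMTriple d T := by
  rw [IsGBSTriple, IsGPMTriple, Set.ncard_image_of_injective _ toKet_injective]
  refine and_congr_right fun _ => ⟨fun h M hM => ?_, ?_⟩
  · obtain ⟨s, t, hs, ht, e⟩ := h _ (Set.mem_image_of_mem _ hM)
    exact ⟨s, t, hs, ht, toKet_injective e⟩
  · rintro h _ ⟨M, hM, rfl⟩
    obtain ⟨s, t, hs, ht, rfl⟩ := h M hM
    exact ⟨s, t, hs, ht, rfl⟩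

theorem IsGBSTriple.exists_image {T : Set (Ket d)} (h : IsGBSTriple d T) :
    ∃ S, IsGPMTriple d S ∧ T = toKet d '' S := by
  have hT : T = toKet d '' (toKet d ⁻¹' T) := by
    refine (Set.image_preimage_eq_of_subset fun φ hφ => ?_).symm
    obtain ⟨s, t, -, -, rfl⟩ := h.2 φ hφ
    exact ⟨_, rfl⟩
  refine ⟨toKet d ⁻¹' T, ?_, hT⟩
  rw [← isGBSTriple_image_iff, ← hT]
  exact h

end kets

/-! ### Counting classes through a system of unique representatives. -/

section quotient

theorem mk_eq_mk_iff_of_existsUnique {α ι : Type*} {s : Setoid α} {r : ι → α}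
    (h : ∀ a, ∃! i, s a (r i)) {i j : ι} :
    (Quotient.mk s (r i) = Quotient.mk s (r j)) ↔ i = j :=
  ⟨fun e => (h (r i)).unique (s.refl _) (Quotient.exact e), fun e => e ▸ rfl⟩

theorem card_quotient_of_existsUnique {α ι : Type*} {s : Setoid α} {r : ι → α}
    (h : ∀ a, ∃! i, s a (r i)) : Nat.card (Quotient s) = Nat.card ι := by
  refine (Nat.card_congr (Equiv.ofBijective (fun i => Quotient.mk s (r i)) ⟨?_, ?_⟩)).symm
  · exact fun i j e => (mk_eq_mk_iff_of_existsUnique h).1 e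
  · intro q
    induction q using Quotient.ind with
    | _ a =>
      obtain ⟨i, hi, -⟩ := h a
      exact ⟨i, Quotient.sound (s.symm hi)⟩

theorem ncard_classes_of_existsUnique {α ι : Type*} {s : Setoid α} {r : ι → α}
    (h : ∀ a, ∃! i, s a (r i)) (F : Set ι) :
    (Quotient.mk s '' (r '' F)).ncard = F.ncard := by
  rw [← Set.image_comp]
  exact Set.ncard_image_of_injective _ fun i j e => (mk_eq_mk_iff_of_existsUnique h).1 e

end quotient

/-! ### The normal forms `tri q x y`: moves between them and their invariants. -/

section normalForm

variable {d : ℕ} [NeZero d]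

/-- The triple of labels `0, (0, q), (q x, q y)`. -/
def tri (q x y : ZMod d) : Fin 3 → ZMod d × ZMod d := ![0, (0, q), (q * x, q * y)]

theorem tri_shear (hd : IsUnit (2 : ZMod d)) (q x y c : ZMod d) :
    TripleEquiv (tri q x y) (tri q x (y + c * x)) := by
  refine TripleEquiv.map_eq (ProjEquiv.shear_snd hd (fun v => v) c) ?_ ?_ ?_ <;>
    ext <;> simp <;> ring

/-- Exchange the first two points, translate the new first point to 0, and negate. -/
theorem tri_flip (q x y : ZMod d) : TripleEquiv (tri q x y) (tri q (-x) (1 - y)) := by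
  refine (TripleEquiv.swap₀₁ _ _ _).trans ((TripleEquiv.map
    (ProjEquiv.add_const (fun v => v) (0, -q)) _ _ _).trans ?_)
  refine TripleEquiv.map_eq (ProjEquiv.mul_unit (fun v => v) (u := (-1 : ZMod d)) (u' := -1)
    (by ring)) ?_ ?_ ?_ <;> ext <;> simp <;> ring

/-- Here the roles of the first and third points are exchanged; a shear repairs the second point
after the translation. -/
theorem tri_neg (hd : IsUnit (2 : ZMod d)) (q x : ZMod d) :
    TripleEquiv (tri q x 0) (tri q (-x) 0) := by
  refine (TripleEquiv.swap₀₂ _ _ _).trans ((TripleEquiv.map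
    (ProjEquiv.add_const (fun v => v) (-(q * x), 0)) _ _ _).trans ?_)
  refine TripleEquiv.map_eq (ProjEquiv.shear_fst hd (fun v => v) x) ?_ ?_ ?_ <;>
    ext <;> simp <;> ring

/-- A cyclic rotation of the three points. After translating the old third point to 0, a scaling by
`(-y, -y')` makes the second coordinate of the new second point `q`, and a shear clears its first
coordinate. Being an even permutation, it keeps the area and hence `x`. -/
theorem tri_rotate (hd : IsUnit (2 : ZMod d)) (q x : ZMod d) {y y' : ZMod d} (h : y * y' = 1) :
    TripleEquiv (tri q x y) (tri q x (1 - y')) := by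
  refine (TripleEquiv.swap₀₂ _ _ _).trans ((TripleEquiv.swap₁₂ _ _ _).trans ((TripleEquiv.map
    (ProjEquiv.add_const (fun v => v) (-(q * x), -(q * y))) _ _ _).trans ((TripleEquiv.map
    (ProjEquiv.mul_unit (fun v => v) (u := -y) (u' := -y') (by linear_combination h))
      _ _ _).trans ?_)))
  refine TripleEquiv.map_eq (ProjEquiv.shear_fst hd (fun v => v) (-(x * y))) ?_ ?_ ?_ <;>
    ext <;> simp only [Prod.fst_add, Prod.snd_add, Prod.fst_zero, Prod.snd_zero]
  · ring
  · ring
  · linear_combination -q * x * y * h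
  · linear_combination q * h
  · linear_combination (q * x - q * x * y) * h
  · linear_combination q * h

/-- Scaling and a shear suffice when the second coordinate is a unit; otherwise the Fourier
transform first exchanges the coordinates. Linearity is recorded so that the gate can also be
applied to labels divisible by `q`. -/
theorem exists_linear_gate (hd : IsUnit (2 : ZMod d)) (a : ZMod d × ZMod d)
    (ha : IsUnit a.1 ∨ IsUnit a.2) :
    ∃ g : ZMod d × ZMod d → ZMod d × ZMod d, ProjEquiv (fun v => v) g ∧
      (∀ (q : ZMod d) b, g (q • b) = q • g b) ∧ g a = (0, 1) := by
  have key (a : ZMod d × ZMod d) (ha : IsUnit a.2) :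
      ∃ g : ZMod d × ZMod d → ZMod d × ZMod d, ProjEquiv (fun v => v) g ∧
        (∀ (q : ZMod d) b, g (q • b) = q • g b) ∧ g a = (0, 1) := by
    obtain ⟨u', hu⟩ := ha.exists_right_inv
    refine ⟨_, (ProjEquiv.mul_unit _ hu).trans (ProjEquiv.shear_fst hd _ (-(a.1 * a.2))), ?_, ?_⟩
    · intro q b
      ext <;> simp <;> ring
    · ext
      · simp only; linear_combination -a.1 * a.2 * hu
      · simp only; linear_combination hu
  rcases ha with ha | ha
  · obtain ⟨g, hg, hl, h1⟩ := key (-a.2, a.1) ha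
    refine ⟨fun v => g (-v.2, v.1), (ProjEquiv.fourier _).trans (hg.comp _), fun q b => ?_, h1⟩
    rw [← hl]; simp
  · exact key a ha

theorem exists_tri (hd : IsUnit (2 : ZMod d)) (v : Fin 3 → ZMod d × ZMod d) (q : ZMod d)
    (a b : ZMod d × ZMod d) (ha : v 1 - v 0 = q • a) (hb : v 2 - v 0 = q • b)
    (hu : IsUnit a.1 ∨ IsUnit a.2) : ∃ x y, TripleEquiv v (tri q x y) := by
  obtain ⟨g, hg, hl, h1⟩ := exists_linear_gate hd a hu
  refine ⟨(g b).1, (g b).2, ?_⟩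
  refine (ProjEquiv.add_const v (-v 0)).tripleEquiv.trans ?_
  have e : (fun i => v i + -v 0) = ![0, q • a, q • b] := by
    funext i; fin_cases i
    · simp
    · simpa [sub_eq_add_neg] using ha
    · simpa [sub_eq_add_neg] using hb
  rw [e]
  have h0 : g 0 = 0 := by simpa using hl 0 0
  refine TripleEquiv.map_eq hg h0 ?_ ?_
  · rw [hl, h1]; simp
  · rw [hl]; rfl

theorem TripleEquiv.injective {v w : Fin 3 → ZMod d × ZMod d} (h : TripleEquiv v w)
    (hv : Function.Injective v) : Function.Injective w := by
  obtain ⟨τ, h⟩ := h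
  obtain ⟨U, hU, hp⟩ := h.exists_conjPairs
  have : Function.Injective fun i => w (τ i) := by
    intro i j e
    have hij := hp i j
    simp only at e
    rw [e, sub_self] at hij
    exact hv (sub_eq_zero.1 (eq_zero_of_mem_conjPairs hU hij))
  intro i j e
  have := @this (τ.symm i) (τ.symm j) (by simpa using e)
  exact τ.symm.injective this

theorem perm_fin_three (τ : Equiv.Perm (Fin 3)) :
    (τ 0 = 0 ∧ τ 1 = 1 ∧ τ 2 = 2 ∧ τ.sign = 1) ∨ (τ 0 = 1 ∧ τ 1 = 2 ∧ τ 2 = 0 ∧ τ.sign = 1) ∨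
    (τ 0 = 2 ∧ τ 1 = 0 ∧ τ 2 = 1 ∧ τ.sign = 1) ∨ (τ 0 = 0 ∧ τ 1 = 2 ∧ τ 2 = 1 ∧ τ.sign = -1) ∨
    (τ 0 = 1 ∧ τ 1 = 0 ∧ τ 2 = 2 ∧ τ.sign = -1) ∨ (τ 0 = 2 ∧ τ 1 = 1 ∧ τ 2 = 0 ∧ τ.sign = -1) := by
  revert τ; decide

/-- The invariants of `TripleEquiv`, evaluated on normal forms. -/
theorem tri_invariants {q x y q' x' y' : ZMod d} (h : TripleEquiv (tri q x y) (tri q' x' y')) :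
    ∃ τ : Equiv.Perm (Fin 3), q * q * x = ((τ.sign : ℤ) : ZMod d) * (q' * q' * x') ∧
      ∀ c : Fin 3 → ZMod d, c 0 + c 1 + c 2 = 0 → c 2 * (q' * x') = 0 →
        q' * (c 1 + c 2 * y') = 0 →
        c (τ 2) * (q * x) = 0 ∧ q * (c (τ 1) + c (τ 2) * y) = 0 := by
  obtain ⟨τ, h1, h2⟩ := h.exists_invariants
  refine ⟨τ, ?_, fun c hc hx hy => ?_⟩
  · rcases perm_fin_three τ with ⟨e0, e1, e2, e⟩ | ⟨e0, e1, e2, e⟩ | ⟨e0, e1, e2, e⟩ |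
      ⟨e0, e1, e2, e⟩ | ⟨e0, e1, e2, e⟩ | ⟨e0, e1, e2, e⟩ <;>
    · rw [e0, e1, e2] at h1
      simp only [tri, sympl, Matrix.cons_val, Prod.fst_sub, Prod.snd_sub, Prod.fst_zero,
        Prod.snd_zero] at h1
      rw [e]
      push_cast
      linear_combination h1
  -- The relation is given on the target's own numbering, so its coefficients are transported along
  -- `τ`.
  · have := h2 (c (τ 0)) (c (τ 1)) (c (τ 2)) ?_ ?_
    · simp only [tri, Matrix.cons_val, smul_zero, zero_add, Prod.smul_mk, smul_eq_mul, mul_zero,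
        Prod.mk_add_mk, Prod.mk_eq_zero] at this
      exact ⟨this.1, by linear_combination this.2⟩
    · rcases perm_fin_three τ with ⟨e0, e1, e2, -⟩ | ⟨e0, e1, e2, -⟩ | ⟨e0, e1, e2, -⟩ |
        ⟨e0, e1, e2, -⟩ | ⟨e0, e1, e2, -⟩ | ⟨e0, e1, e2, -⟩ <;>
      · rw [e0, e1, e2]; linear_combination hc
    · rcases perm_fin_three τ with ⟨e0, e1, e2, -⟩ | ⟨e0, e1, e2, -⟩ | ⟨e0, e1, e2, -⟩ |
        ⟨e0, e1, e2, -⟩ | ⟨e0, e1, e2, -⟩ | ⟨e0, e1, e2, -⟩ <;>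
      · rw [e0, e1, e2]
        simp only [tri, Matrix.cons_val, smul_zero, zero_add, add_zero, Prod.smul_mk, smul_eq_mul,
          mul_zero, Prod.mk_add_mk, Prod.mk_eq_zero]
        exact ⟨hx, by linear_combination hy⟩

end normalForm

/-! ### The classes `sixClass` and `threeClass` and their minima. -/

section classes

variable {n : ℕ}

theorem inv_eq_of_mul_eq_one {a b : ZMod n} (h : a * b = 1) : a⁻¹ = b := by
  have ha : IsUnit a := IsUnit.of_mul_eq_one b h
  have := ZMod.inv_mul_of_unit a ha
  calc a⁻¹ = a⁻¹ * (a * b) := by rw [h, mul_one]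
    _ = b := by rw [← mul_assoc, this, one_mul]

/-- An equivalence relation stable under `y ↦ 1 - y` and `y ↦ 1 - y⁻¹` contains `sixClass`. -/
theorem rel_of_mem_sixClass {r : ZMod n → ZMod n → Prop} (hr : ∀ y, r y y)
    (ht : ∀ {x y z}, r x y → r y z → r x z)
    (h1 : ∀ y, r y (1 - y)) (h2 : ∀ y y', y * y' = 1 → r y (1 - y')) {x y : ZMod n}
    (h : y ∈ sixClass x) : r x y := by
  have hinv : ∀ y y', y * y' = 1 → r y y' := fun y y' e => by
    simpa using ht (h2 y y' e) (h1 _)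
  rcases h with rfl | ⟨hx, rfl⟩ | rfl | ⟨hx, rfl⟩ | ⟨hx, rfl⟩ | ⟨hx, rfl⟩
  · exact hr _
  · exact hinv _ _ (ZMod.mul_inv_of_unit _ hx)
  · exact h1 _
  · exact ht (h1 _) (hinv _ _ (ZMod.mul_inv_of_unit _ hx))
  · exact h2 _ _ (ZMod.mul_inv_of_unit _ hx)
  · have e := ZMod.mul_inv_of_unit _ hx
    have : x * (x - 1)⁻¹ = 1 - -(x - 1)⁻¹ := by linear_combination e
    rw [this]
    exact ht (h1 _) (h2 _ _ (by linear_combination e))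

/-- Transitivity is not needed: `(1 - x)⁻¹` is the preimage of `x` under `y ↦ 1 - y⁻¹`, so symmetry
reaches it. -/
theorem rel_of_mem_threeClass {r : ZMod n → ZMod n → Prop} (hr : ∀ y, r y y)
    (hs : ∀ {x y}, r x y → r y x) (h2 : ∀ y y', y * y' = 1 → r y (1 - y')) {x y : ZMod n}
    (h : y ∈ threeClass x) : r x y := by
  rcases h with rfl | ⟨hx, rfl⟩ | ⟨hx, rfl⟩
  · exact hr _
  · exact h2 _ _ (ZMod.mul_inv_of_unit _ hx)
  · refine hs ?_
    simpa using h2 (1 - x)⁻¹ (1 - x) (ZMod.inv_mul_of_unit _ hx)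

/-- The vector `(x - 1, -x, 1)` is the affine relation of the points `0, 1, x`. The hypothesis says
that its rearrangement by `τ` is a relation of `0, 1, y`; the six permutations give the six
substitutions, the even ones the three of `threeClass`. -/
theorem mem_class_of_perm {x y : ZMod n} {τ : Equiv.Perm (Fin 3)}
    (h : ![x - 1, -x, 1] (τ 1) + ![x - 1, -x, 1] (τ 2) * y = 0) :
    y ∈ sixClass x ∧ (τ.sign = 1 → y ∈ threeClass x) := by
  rcases perm_fin_three τ with ⟨e0, e1, e2, e⟩ | ⟨e0, e1, e2, e⟩ | ⟨e0, e1, e2, e⟩ |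
    ⟨e0, e1, e2, e⟩ | ⟨e0, e1, e2, e⟩ | ⟨e0, e1, e2, e⟩ <;>
  · rw [e1, e2] at h
    simp only [Matrix.cons_val] at h
    have hne : (-1 : ℤˣ) ≠ 1 := by decide
    simp only [e, hne, true_imp_iff, false_imp_iff, and_true]
    first
    | have h' : y = x := by linear_combination h
      exact ⟨Or.inl h', Or.inl h'⟩
    | have h' : (1 - x) * y = 1 := by linear_combination -h
      have hu := IsUnit.of_mul_eq_one _ h'
      have hi := (inv_eq_of_mul_eq_one h').symm
      exact ⟨Or.inr (Or.inr (Or.inr (Or.inl ⟨hu, hi⟩))), Or.inr (Or.inr ⟨hu, hi⟩)⟩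
    | have h' : x * (1 - y) = 1 := by linear_combination h
      have hu := IsUnit.of_mul_eq_one _ h'
      have hi : y = 1 - x⁻¹ := by rw [inv_eq_of_mul_eq_one h']; ring
      exact ⟨Or.inr (Or.inr (Or.inr (Or.inr (Or.inl ⟨hu, hi⟩)))), Or.inr (Or.inl ⟨hu, hi⟩)⟩
    | have h' : x * y = 1 := by linear_combination -h
      exact Or.inr (Or.inl ⟨IsUnit.of_mul_eq_one _ h', (inv_eq_of_mul_eq_one h').symm⟩)
    | have h' : y = 1 - x := by linear_combination h
      exact Or.inr (Or.inr (Or.inl h'))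
    | have h' : (x - 1) * (y - 1) = 1 := by linear_combination h
      refine Or.inr (Or.inr (Or.inr (Or.inr (Or.inr ⟨IsUnit.of_mul_eq_one _ h', ?_⟩))))
      rw [inv_eq_of_mul_eq_one h']
      linear_combination -h'

theorem exists_isMinOf [NeZero n] {S : Set (ZMod n)} (hS : S.Nonempty) :
    ∃ m, IsMinOf S m ∧ (m : ZMod n) ∈ S := by
  classical
  have h : (ZMod.val '' S).Nonempty := hS.image _
  obtain ⟨z, hz, e⟩ := Nat.sInf_mem h
  refine ⟨sInf (ZMod.val '' S), ⟨Nat.sInf_mem h, fun k hk => Nat.sInf_le hk⟩, ?_⟩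
  rw [← e, ZMod.natCast_zmod_val]
  exact hz

theorem IsMinOf.cast_mem [NeZero n] {S : Set (ZMod n)} {m : ℕ} (h : IsMinOf S m) :
    (m : ZMod n) ∈ S := by
  obtain ⟨z, hz, rfl⟩ := h.1
  rwa [ZMod.natCast_zmod_val]

theorem IsMinOf.lt [NeZero n] {S : Set (ZMod n)} {m : ℕ} (h : IsMinOf S m) : m < n := by
  obtain ⟨z, hz, rfl⟩ := h.1
  exact ZMod.val_lt z

theorem IsMinOf.le_of_mem [NeZero n] {S : Set (ZMod n)} {m k : ℕ} (h : IsMinOf S m) (hk : k < n)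
    (hS : (k : ZMod n) ∈ S) : m ≤ k :=
  h.2 ⟨_, hS, ZMod.val_cast_of_lt hk⟩

end classes

/-! ### Arithmetic of `ℤ/p²` and reduction of every triple to a representative. -/

section primeSq

variable {p : ℕ} [hp : Fact p.Prime]

/-- Reduction modulo `p`. -/
def red (p : ℕ) : ZMod (p ^ 2) →+* ZMod p := ZMod.castHom (dvd_pow_self p two_ne_zero) (ZMod p)

theorem red_natCast (n : ℕ) : red p n = n := map_natCast _ _

theorem red_eq_zero_iff (a : ZMod (p ^ 2)) : red p a = 0 ↔ ∃ b, a = p * b := by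
  constructor
  · intro h
    obtain ⟨n, rfl⟩ := ZMod.natCast_zmod_surjective a
    rw [red_natCast, ZMod.natCast_eq_zero_iff] at h
    obtain ⟨k, rfl⟩ := h
    exact ⟨k, by push_cast; ring⟩
  · rintro ⟨b, rfl⟩
    rw [map_mul, red_natCast]; simp

theorem p_mul_eq_zero_iff (a : ZMod (p ^ 2)) : (p : ZMod (p ^ 2)) * a = 0 ↔ red p a = 0 := by
  obtain ⟨n, rfl⟩ := ZMod.natCast_zmod_surjective a
  rw [red_natCast, ← Nat.cast_mul, ZMod.natCast_eq_zero_iff, ZMod.natCast_eq_zero_iff, pow_two]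
  exact Nat.mul_dvd_mul_iff_left hp.out.pos

theorem p_mul_eq_p_mul_iff (a b : ZMod (p ^ 2)) :
    (p : ZMod (p ^ 2)) * a = (p : ZMod (p ^ 2)) * b ↔ red p a = red p b := by
  rw [← sub_eq_zero, ← mul_sub, p_mul_eq_zero_iff, map_sub, sub_eq_zero]

theorem p_mul_p : (p : ZMod (p ^ 2)) * p = 0 := by
  rw [p_mul_eq_zero_iff, red_natCast]; simp

theorem p_ne_zero : (p : ZMod (p ^ 2)) ≠ 0 := by
  have : ¬ ((p : ZMod (p ^ 2)) * 1 = 0) := by rw [p_mul_eq_zero_iff]; simp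
  simpa using this

theorem isUnit_iff_red (a : ZMod (p ^ 2)) : IsUnit a ↔ red p a ≠ 0 := by
  obtain ⟨n, rfl⟩ := ZMod.natCast_zmod_surjective a
  rw [red_natCast, ZMod.isUnit_iff_coprime, Ne, ZMod.natCast_eq_zero_iff,
    Nat.coprime_pow_right_iff two_pos, Nat.coprime_comm, hp.out.coprime_iff_not_dvd]

theorem isUnit_two (h2 : 2 < p) : IsUnit (2 : ZMod (p ^ 2)) := by
  rw [isUnit_iff_red]
  have : red p 2 = ((2 : ℕ) : ZMod p) := by rw [← red_natCast]; simp
  rw [this, Ne, ZMod.natCast_eq_zero_iff]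
  exact Nat.not_dvd_of_pos_of_lt two_pos h2

/-- The standard lift of the residue of `k` modulo `p`. -/
def residue (k : ZMod (p ^ 2)) : ZMod (p ^ 2) := ((red p k).val : ZMod (p ^ 2))

theorem red_residue (k : ZMod (p ^ 2)) : red p (residue k) = red p k := by
  rw [residue, red_natCast, ZMod.natCast_zmod_val]

/-- The labels `(0, p)` and `(p x, 0)` have area zero, so the area does not see `x`. The basis
permutation fixes each residue mod `p` and multiplies the displacement within a residue class by
`x`: it commutes with `Z ^ p` and carries the shift by `p` to the shift by `p x`. For general `x` it
is not an affine map. -/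
theorem tri_scale {x : ZMod (p ^ 2)} (hx : IsUnit x) :
    TripleEquiv (tri (p : ZMod (p ^ 2)) x 0) (tri p 1 0) := by
  refine (ProjEquiv.tripleEquiv ?_ : TripleEquiv (tri (p : ZMod (p ^ 2)) 1 0) (tri p x 0)).symm
  have hf (k : ZMod (p ^ 2)) : red p (residue k + x * (k - residue k)) = red p k := by
    rw [map_add, map_mul, map_sub, red_residue]; ring
  have hr (k : ZMod (p ^ 2)) : residue (k + (p : ZMod (p ^ 2))) = residue k := by
    rw [residue, map_add, red_natCast]; simp [residue]
  refine ProjEquiv.monomial (fun k => residue k + x * (k - residue k)) ?_ (fun _ => 1) (by simp) ?_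
    (fun _ => 1) (by simp) ?_
  · intro a b h
    have h' : red p a = red p b := by rw [← hf a, ← hf b]; exact congrArg _ h
    have e : residue a = residue b := by rw [residue, residue, h']
    simp only [e] at h
    have := hx.mul_left_cancel (add_left_cancel h)
    exact sub_left_injective this
  · intro i j
    fin_cases i
    · simp [tri]
    · simp [tri]
    · simp only [tri, Fin.reduceFinMk, Matrix.cons_val, mul_one, hr]; ring
  · intro i j
    fin_cases i
    · simp [tri]
    · simp only [tri, Fin.mk_one, Matrix.cons_val, one_mul, mul_one]
      rw [(p_mul_eq_p_mul_iff _ _).2 (hf j)]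
    · simp [tri]

theorem isUnit_or_of_smul_ne_zero {a : ZMod (p ^ 2) × ZMod (p ^ 2)}
    (h : (p : ZMod (p ^ 2)) • a ≠ 0) : IsUnit a.1 ∨ IsUnit a.2 := by
  rw [isUnit_iff_red, isUnit_iff_red]
  by_contra! hc
  exact h (Prod.ext ((p_mul_eq_zero_iff _).2 hc.1) ((p_mul_eq_zero_iff _).2 hc.2))

/-- Either some difference of labels has a unit coordinate, and renumbering makes it the first side
with `q = 1`, or all differences are divisible by `p`, and a nonzero one is `p` times a vector with
a unit coordinate. -/
theorem exists_normalForm (h2 : 2 < p) {v : Fin 3 → ZMod (p ^ 2) × ZMod (p ^ 2)}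
    (hv : Function.Injective v) :
    ∃ x y, TripleEquiv v (tri 1 x y) ∨ TripleEquiv v (tri (p : ZMod (p ^ 2)) x y) := by
  have hd := isUnit_two h2
  by_cases h : ∃ i j, IsUnit (v i - v j).1 ∨ IsUnit (v i - v j).2
  · obtain ⟨i, j, h⟩ := h
    have hij : j ≠ i := by
      rintro rfl
      have : Nontrivial (ZMod (p ^ 2)) := ⟨_, _, p_ne_zero⟩
      simp at h
    obtain ⟨τ, rfl, rfl⟩ : ∃ τ : Equiv.Perm (Fin 3), τ 0 = j ∧ τ 1 = i := by
      have key : ∀ i j : Fin 3, j ≠ i → ∃ τ : Equiv.Perm (Fin 3), τ 0 = j ∧ τ 1 = i := by decide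
      exact key i j hij
    obtain ⟨x, y, e⟩ := exists_tri hd (fun i => v (τ i)) 1 _ _ (one_smul _ _).symm
      (one_smul _ _).symm h
    exact ⟨x, y, Or.inl ((TripleEquiv.perm v τ).symm.trans e)⟩
  · push Not at h
    have key (i j) : ∃ a, v i - v j = (p : ZMod (p ^ 2)) • a := by
      have hij := h i j
      rw [isUnit_iff_red, isUnit_iff_red, not_not, not_not, red_eq_zero_iff, red_eq_zero_iff] at hij
      obtain ⟨⟨a, ha⟩, b, hb⟩ := hij
      exact ⟨(a, b), Prod.ext ha hb⟩
    obtain ⟨a, ha⟩ := key 1 0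
    obtain ⟨b, hb⟩ := key 2 0
    obtain ⟨x, y, e⟩ := exists_tri hd v p a b ha hb (isUnit_or_of_smul_ne_zero (by
      rw [← ha, sub_ne_zero]; exact fun e => absurd (hv e) (by decide)))
    exact ⟨x, y, Or.inr e⟩

theorem tri_p_congr {x y x' y' : ZMod (p ^ 2)} (hx : red p x = red p x') (hy : red p y = red p y') :
    tri (p : ZMod (p ^ 2)) x y = tri p x' y' := by
  rw [tri, tri, (p_mul_eq_p_mul_iff _ _).2 hx, (p_mul_eq_p_mul_iff _ _).2 hy]

/-- A shear moves `y` by any multiple of `p k`, hence by any multiple of `p`. -/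
theorem tri_one_p_mul_congr (h2 : 2 < p) {k y y' : ZMod (p ^ 2)} (hk : red p k ≠ 0)
    (hy : red p y = red p y') : TripleEquiv (tri 1 ((p : ZMod (p ^ 2)) * k) y) (tri 1 ((p : ZMod (p ^ 2)) * k) y') := by
  obtain ⟨k', hk'⟩ := ((isUnit_iff_red k).2 hk).exists_right_inv
  obtain ⟨b, hb⟩ := (red_eq_zero_iff (y' - y)).1 (by rw [map_sub, hy, sub_self])
  have := tri_shear (isUnit_two h2) 1 (p * k) y (b * k')
  have e : y + b * k' * (p * k) = y' := by linear_combination (p : ZMod (p ^ 2)) * b * hk' - hb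
  rwa [e] at this

theorem tri_of_mem_sixClass (h2 : 2 < p) {y y' : ZMod (p ^ 2)} (h : y' ∈ sixClass y) :
    TripleEquiv (tri 1 0 y) (tri 1 0 y') :=
  rel_of_mem_sixClass (r := fun y y' => TripleEquiv (tri (1 : ZMod (p ^ 2)) 0 y) (tri 1 0 y'))
    (fun _ => TripleEquiv.refl _) TripleEquiv.trans (fun y => by simpa using tri_flip 1 0 y)
    (fun _ _ e => tri_rotate (isUnit_two h2) 1 0 e) h

theorem red_surjective : Function.Surjective (red p) := fun a =>
  ⟨(a.val : ZMod (p ^ 2)), by rw [red_natCast, ZMod.natCast_zmod_val]⟩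

theorem exists_right_inv_of_red {y : ZMod (p ^ 2)} {b : ZMod p} (h : red p y * b = 1) :
    ∃ y', y * y' = 1 ∧ red p y' = b := by
  have hy : red p y ≠ 0 := by rintro e; rw [e, zero_mul] at h; exact zero_ne_one h
  obtain ⟨y', h'⟩ := ((isUnit_iff_red y).2 hy).exists_right_inv
  refine ⟨y', h', mul_left_cancel₀ hy ?_⟩
  rw [← map_mul, h', h, map_one]

theorem tri_of_red_mem_sixClass (h2 : 2 < p) {y y' : ZMod (p ^ 2)}
    (h : red p y' ∈ sixClass (red p y)) :
    TripleEquiv (tri (p : ZMod (p ^ 2)) 0 y) (tri p 0 y') := by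
  -- The relation lives on `ℤ/p` and quantifies over all lifts, so that an inverse mod `p` may be
  -- replaced by an inverse of a lift.
  refine rel_of_mem_sixClass (r := fun a b => ∀ y y', red p y = a → red p y' = b →
    TripleEquiv (tri (p : ZMod (p ^ 2)) 0 y) (tri p 0 y')) ?_ ?_ ?_ ?_ h _ _ rfl rfl
  · rintro _ y y' e rfl
    rw [tri_p_congr rfl e]
    exact TripleEquiv.refl _
  · intro a b c hab hbc y z hy hz
    obtain ⟨w, hw⟩ := red_surjective b
    exact (hab y w hy hw).trans (hbc w z hw hz)
  · rintro _ y y' rfl e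
    rw [tri_p_congr rfl (e.trans (by rw [map_sub, map_one]) : red p y' = red p (1 - y))]
    simpa using tri_flip (p : ZMod (p ^ 2)) 0 y
  · rintro _ b e y y' rfl hy'
    obtain ⟨z, hz, rfl⟩ := exists_right_inv_of_red e
    rw [tri_p_congr rfl (hy'.trans (by rw [map_sub, map_one]) : red p y' = red p (1 - z))]
    exact tri_rotate (isUnit_two h2) _ _ hz

theorem tri_of_red_mem_threeClass (h2 : 2 < p) {k y y' : ZMod (p ^ 2)} (hk : red p k ≠ 0)
    (h : red p y' ∈ threeClass (red p y)) :
    TripleEquiv (tri 1 ((p : ZMod (p ^ 2)) * k) y) (tri 1 ((p : ZMod (p ^ 2)) * k) y') := by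
  refine rel_of_mem_threeClass (r := fun a b => ∀ y y', red p y = a → red p y' = b →
    TripleEquiv (tri 1 ((p : ZMod (p ^ 2)) * k) y) (tri 1 ((p : ZMod (p ^ 2)) * k) y')) ?_ ?_ ?_ h _ _ rfl rfl
  · rintro _ y y' e rfl
    exact tri_one_p_mul_congr h2 hk e
  · intro a b hab y z hy hz
    exact (hab z y hz hy).symm
  · rintro _ b e y y' rfl hy'
    obtain ⟨z, hz, rfl⟩ := exists_right_inv_of_red e
    refine (tri_rotate (isUnit_two h2) _ _ hz).trans (tri_one_p_mul_congr h2 hk ?_)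
    rw [hy', map_sub, map_one]

/-- The labels of the representing triples. -/
def repLabels : RepIndex p → Fin 3 → ZMod (p ^ 2) × ZMod (p ^ 2)
  | .M s _ => tri 1 s 0
  | .Nk k m _ _ => tri 1 ((p : ZMod (p ^ 2)) * k) m
  | .N m _ => tri 1 0 m
  | .M₀ => tri p 1 0
  | .W m _ => tri p 0 m

theorem rep_eq_range (i : RepIndex p) : rep p i = Set.range fun j => weyl (repLabels i j) := by
  have key (q x y : ZMod (p ^ 2)) : (Set.range fun j => weyl (tri q x y j))
      = {1, weyl (0, q), weyl (q * x, q * y)} := by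
    ext M
    simp [Set.mem_range, Fin.exists_fin_succ, eq_comm, tri, weyl_zero]
  cases i with
  | M s hs => simp only [rep, repLabels, key, clockZ_eq, shiftX_pow, one_mul]
  | Nk k m hk hm =>
    simp only [rep, repLabels, key, shiftX_pow_mul_clockZ_pow, one_mul, Nat.cast_mul]
    rw [clockZ_eq, mul_comm]
  | N m hm => simp only [rep, repLabels, key, clockZ_eq, ← clockZ_pow, one_mul]
  | M₀ => simp only [rep, repLabels, key, clockZ_pow, shiftX_pow, mul_one, mul_zero]
  | W m hm =>
    simp only [rep, repLabels, key, clockZ_pow, mul_zero, Nat.cast_mul, mul_comm]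

theorem two_le_val {n : ℕ} (hn : 2 ≤ n) {y : ZMod n} (h0 : y ≠ 0) (h1 : y ≠ 1) : 2 ≤ y.val := by
  have : NeZero n := ⟨by omega⟩
  by_contra! h
  interval_cases hy : y.val
  · exact h0 ((ZMod.val_eq_zero y).1 hy)
  · apply h1
    rw [← ZMod.natCast_zmod_val y, hy, Nat.cast_one]

theorem exists_repLabels_M (h2 : 2 < p) {x : ZMod (p ^ 2)} (hx : x ≠ 0) :
    ∃ i : RepIndex p, TripleEquiv (tri 1 x 0) (repLabels i) := by
  have hpos : x.val ≠ 0 := fun e => hx ((ZMod.val_eq_zero x).1 e)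
  have hlt := ZMod.val_lt x
  by_cases h : x.val ≤ p ^ 2 / 2
  · refine ⟨.M x.val ⟨by omega, h⟩, ?_⟩
    rw [repLabels, ZMod.natCast_zmod_val]
    exact TripleEquiv.refl _
  · refine ⟨.M (p ^ 2 - x.val) ⟨by omega, by omega⟩, ?_⟩
    rw [repLabels, Nat.cast_sub hlt.le, ZMod.natCast_self, ZMod.natCast_zmod_val, zero_sub]
    exact tri_neg (isUnit_two h2) _ _

theorem exists_repLabels_Nk_half (h2 : 2 < p) {κ : ℕ} (hκ : 1 ≤ κ ∧ κ ≤ (p - 1) / 2)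
    {y : ZMod (p ^ 2)} (h0 : red p y ≠ 0) (h1 : red p y ≠ 1) :
    ∃ i : RepIndex p, TripleEquiv (tri 1 ((p : ZMod (p ^ 2)) * (κ : ZMod (p ^ 2))) y) (repLabels i) := by
  obtain ⟨m, hm, hm'⟩ := exists_isMinOf (n := p) (S := threeClass (red p y)) ⟨_, Or.inl rfl⟩
  refine ⟨.Nk κ m hκ ⟨(red p y).val, two_le_val h2.le h0 h1, ?_, ?_⟩, ?_⟩
  · have := ZMod.val_lt (red p y); omega
  · rwa [ZMod.natCast_zmod_val]
  · refine tri_of_red_mem_threeClass h2 ?_ (by rwa [red_natCast])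
    rw [red_natCast, Ne, ZMod.natCast_eq_zero_iff]
    exact Nat.not_dvd_of_pos_of_lt (by omega) (by omega)

theorem exists_repLabels_Nk (h2 : 2 < p) {k y : ZMod (p ^ 2)} (hk : red p k ≠ 0)
    (h0 : red p y ≠ 0) (h1 : red p y ≠ 1) :
    ∃ i : RepIndex p, TripleEquiv (tri 1 ((p : ZMod (p ^ 2)) * k) y) (repLabels i) := by
  have hpos : (red p k).val ≠ 0 := fun e => hk ((ZMod.val_eq_zero _).1 e)
  have hlt := ZMod.val_lt (red p k)
  obtain ⟨t, ht⟩ := hp.out.odd_of_ne_two (by omega)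
  by_cases h : (red p k).val ≤ (p - 1) / 2
  · have e : (p : ZMod (p ^ 2)) * k = (p : ZMod (p ^ 2)) * ((red p k).val : ZMod (p ^ 2)) := by
      rw [p_mul_eq_p_mul_iff, red_natCast, ZMod.natCast_zmod_val]
    rw [e]
    exact exists_repLabels_Nk_half h2 ⟨by omega, h⟩ h0 h1
  -- For `k` in the upper half, `tri_flip` replaces `k` by `-k` and `y` by `1 - y`, which still
  -- avoids 0 and 1 mod `p`.
  · have e : -((p : ZMod (p ^ 2)) * k) = (p : ZMod (p ^ 2)) * ((p - (red p k).val : ℕ) : ZMod (p ^ 2)) := by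
      rw [← mul_neg, p_mul_eq_p_mul_iff, red_natCast, Nat.cast_sub hlt.le, ZMod.natCast_self,
        ZMod.natCast_zmod_val, zero_sub, map_neg]
    have hf := tri_flip 1 ((p : ZMod (p ^ 2)) * k) y
    rw [e] at hf
    obtain ⟨i, hi⟩ := exists_repLabels_Nk_half h2 (κ := p - (red p k).val)
      ⟨by omega, by omega⟩ (y := 1 - y) (by rw [map_sub, map_one, sub_ne_zero]; exact h1.symm)
      (by simpa using h0)
    exact ⟨i, hf.trans hi⟩

theorem exists_repLabels (h2 : 2 < p) {v : Fin 3 → ZMod (p ^ 2) × ZMod (p ^ 2)}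
    (hv : Function.Injective v) : ∃ i : RepIndex p, TripleEquiv v (repLabels i) := by
  have hd := isUnit_two h2
  obtain ⟨x, y, h | h⟩ := exists_normalForm h2 hv
  · suffices ∃ i : RepIndex p, TripleEquiv (tri 1 x y) (repLabels i) from
      this.imp fun i hi => h.trans hi
    have hinj := h.injective hv
    by_cases hx : red p x = 0
    · obtain ⟨k, rfl⟩ := (red_eq_zero_iff x).1 hx
      by_cases hk : red p k = 0
      · rw [(p_mul_eq_zero_iff k).2 hk] at hinj ⊢
        have h0 : y ≠ 0 := by
          rintro rfl
          exact absurd (@hinj 0 2 (by ext <;> simp [tri])) (by decide)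
        have h1 : y ≠ 1 := by
          rintro rfl
          exact absurd (@hinj 1 2 (by simp [tri])) (by decide)
        obtain ⟨m, hm, hm'⟩ := exists_isMinOf (n := p ^ 2) (S := sixClass y) ⟨_, Or.inl rfl⟩
        exact ⟨.N m ⟨y.val, two_le_val (by nlinarith) h0 h1, ZMod.val_lt y, by
          rwa [ZMod.natCast_zmod_val]⟩, tri_of_mem_sixClass h2 hm'⟩
      · by_cases h0 : red p y = 0
        · obtain ⟨i, hi⟩ := exists_repLabels_M h2 (x := (p : ZMod (p ^ 2)) * k) (by rwa [Ne, p_mul_eq_zero_iff])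
          exact ⟨i, (tri_one_p_mul_congr h2 hk (by rw [h0, map_zero])).trans hi⟩
        -- Flipping makes `y` vanish mod `p`, so this is again a triple of type `M`, with `k`
        -- negated.
        by_cases h1 : red p y = 1
        · obtain ⟨i, hi⟩ := exists_repLabels_M h2 (x := (p : ZMod (p ^ 2)) * -k)
            (by rwa [Ne, p_mul_eq_zero_iff, map_neg, neg_eq_zero])
          have hf := tri_flip 1 ((p : ZMod (p ^ 2)) * k) y
          rw [← mul_neg] at hf
          exact ⟨i, (hf.trans (tri_one_p_mul_congr h2 (by rwa [map_neg, neg_ne_zero])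
            (by simp [h1]))).trans hi⟩
        · exact exists_repLabels_Nk h2 hk h0 h1
    · obtain ⟨x', hx'⟩ := ((isUnit_iff_red x).2 hx).exists_right_inv
      obtain ⟨i, hi⟩ := exists_repLabels_M h2 (x := x) (by rintro rfl; simp at hx)
      have hs := tri_shear hd 1 x y (-(y * x'))
      have e : y + -(y * x') * x = 0 := by linear_combination -y * hx'
      rw [e] at hs
      exact ⟨i, hs.trans hi⟩
  · suffices ∃ i : RepIndex p, TripleEquiv (tri (p : ZMod (p ^ 2)) x y) (repLabels i) from
      this.imp fun i hi => h.trans hi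
    have hinj := h.injective hv
    by_cases hx : red p x = 0
    · rw [tri_p_congr (hx.trans (map_zero _).symm) rfl] at hinj ⊢
      have h0 : red p y ≠ 0 := by
        intro e
        rw [← p_mul_eq_zero_iff] at e
        exact absurd (@hinj 0 2 (by ext <;> simp [tri, e])) (by decide)
      have h1 : red p y ≠ 1 := by
        intro e
        rw [← map_one (red p), ← p_mul_eq_p_mul_iff] at e
        exact absurd (@hinj 1 2 (by simp [tri, e])) (by decide)
      obtain ⟨m, hm, hm'⟩ := exists_isMinOf (n := p) (S := sixClass (red p y)) ⟨_, Or.inl rfl⟩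
      refine ⟨.W m ⟨(red p y).val, two_le_val h2.le h0 h1, ?_, ?_⟩,
        tri_of_red_mem_sixClass h2 (by rwa [red_natCast])⟩
      · have := ZMod.val_lt (red p y); omega
      · rwa [ZMod.natCast_zmod_val]
    · have hu := (isUnit_iff_red x).2 hx
      obtain ⟨x', hx'⟩ := hu.exists_right_inv
      have hs := tri_shear hd (p : ZMod (p ^ 2)) x y (-(y * x'))
      have e : y + -(y * x') * x = 0 := by linear_combination -y * hx'
      rw [e] at hs
      exact ⟨.M₀, hs.trans (tri_scale hu)⟩

end primeSq

/-! ### Inequivalence of the representatives. -/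

section uniqueness

theorem natCast_ne_zero_one {n s : ℕ} (h2 : 2 ≤ s) (hn : s < n) :
    (s : ZMod n) ≠ 0 ∧ (s : ZMod n) ≠ 1 := by
  have hs := ZMod.val_cast_of_lt hn
  constructor
  · intro h; rw [h, ZMod.val_zero] at hs; omega
  · intro h
    have h1 := ZMod.val_cast_of_lt (n := n) (a := 1) (by omega)
    rw [h] at hs; rw [Nat.cast_one] at h1; omega

theorem sixClass_ne {n : ℕ} {x y : ZMod n} (hx : x ≠ 0 ∧ x ≠ 1) (h : y ∈ sixClass x) :
    y ≠ 0 ∧ y ≠ 1 := by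
  refine rel_of_mem_sixClass (r := fun x y : ZMod n => x ≠ 0 ∧ x ≠ 1 → y ≠ 0 ∧ y ≠ 1)
    (fun _ h => h) (fun h h' e => h' (h e)) ?_ ?_ h hx
  · rintro y ⟨h0, h1⟩
    exact ⟨fun e => h1 (by linear_combination -e), fun e => h0 (by linear_combination -e)⟩
  · rintro y y' e ⟨h0, h1⟩
    refine ⟨fun e' => h1 (by linear_combination e + y * e'), fun e' => h0 ?_⟩
    have hy : y' = 0 := by linear_combination -e'
    rw [hy, mul_zero] at e
    rw [← mul_one y, ← e, mul_zero]

theorem threeClass_subset_sixClass {n : ℕ} (x : ZMod n) : threeClass x ⊆ sixClass x := by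
  rintro y (h | h | h)
  · exact Or.inl h
  · exact Or.inr (Or.inr (Or.inr (Or.inr (Or.inl h))))
  · exact Or.inr (Or.inr (Or.inr (Or.inl h)))

/-- Two classes of one equivalence relation that meet coincide, and then so do their minima. -/
theorem eq_of_isMinOf {n : ℕ} [NeZero n] {C : ZMod n → Set (ZMod n)} {r : ZMod n → ZMod n → Prop}
    (hr : Equivalence r) (hC : ∀ x y, r x y ↔ y ∈ C x) {s s' : ZMod n} {m m' : ℕ}
    (hm : IsMinOf (C s) m) (hm' : IsMinOf (C s') m') (h : r m m') : m = m' := by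
  have h1 := (hC _ _).2 hm.cast_mem
  have h2 := (hC _ _).2 hm'.cast_mem
  exact le_antisymm (hm.le_of_mem hm'.lt ((hC _ _).1 (hr.trans h1 h)))
    (hm'.le_of_mem hm.lt ((hC _ _).1 (hr.trans h2 (hr.symm h))))

theorem tri_injective {d : ℕ} [NeZero d] {q x y : ZMod d} (hq : q ≠ 0) (h0 : ¬ (q * x = 0 ∧ q * y = 0))
    (h1 : ¬ (q * x = 0 ∧ q * y = q)) : Function.Injective (tri q x y) := by
  intro i j
  fin_cases i <;> fin_cases j <;> simp [tri, Prod.ext_iff, hq, Ne.symm hq] <;> intro a b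
  · exact h0 ⟨a.symm, b.symm⟩
  · exact h1 ⟨a.symm, b.symm⟩
  · exact h0 ⟨a, b⟩
  · exact h1 ⟨a, b⟩

variable {p : ℕ} [hp : Fact p.Prime]

theorem sixClass_of_tri {y y' : ZMod (p ^ 2)} (h : TripleEquiv (tri 1 0 y) (tri 1 0 y')) :
    y ∈ sixClass y' := by
  obtain ⟨τ, -, hc⟩ := tri_invariants h
  have := (hc ![y' - 1, -y', 1] (by simp; ring) (by simp) (by simp)).2
  rw [one_mul] at this
  exact (mem_class_of_perm this).1

theorem red_vec (y : ZMod (p ^ 2)) (i : Fin 3) :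
    red p (![y - 1, -y, 1] i) = ![red p y - 1, -red p y, 1] i := by
  fin_cases i <;> simp

theorem sixClass_of_tri_p {y y' : ZMod (p ^ 2)}
    (h : TripleEquiv (tri (p : ZMod (p ^ 2)) 0 y) (tri (p : ZMod (p ^ 2)) 0 y')) :
    red p y ∈ sixClass (red p y') := by
  obtain ⟨τ, -, hc⟩ := tri_invariants h
  have := (hc ![y' - 1, -y', 1] (by simp; ring) (by simp) (by simp)).2
  rw [p_mul_eq_zero_iff, map_add, map_mul, red_vec, red_vec] at this
  exact (mem_class_of_perm this).1

theorem sign_cases (τ : Equiv.Perm (Fin 3)) {n : ℕ} :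
    τ.sign = 1 ∧ ((τ.sign : ℤ) : ZMod n) = 1 ∨ ((τ.sign : ℤ) : ZMod n) = -1 := by
  rcases Int.units_eq_one_or τ.sign with h | h
  · left; simp [h]
  · right; simp [h]

theorem half_eq_of_eq_or_neg {n k k' : ℕ} {ε : ZMod n} (hk : 1 ≤ k ∧ 2 * k < n)
    (hk' : 1 ≤ k' ∧ 2 * k' < n) (hε : ε = 1 ∨ ε = -1) (h : (k : ZMod n) = ε * k') :
    k = k' ∧ ε = 1 := by
  rcases hε with rfl | rfl
  · rw [one_mul] at h
    have := congrArg ZMod.val h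
    rw [ZMod.val_cast_of_lt (by omega), ZMod.val_cast_of_lt (by omega)] at this
    exact ⟨this, rfl⟩
  · have : ((k + k' : ℕ) : ZMod n) = 0 := by push_cast; rw [h]; ring
    rw [ZMod.natCast_eq_zero_iff] at this
    have := Nat.le_of_dvd (by omega) this
    omega

/-- The area gives `k = ± k'` mod `p`; with both in the lower half the sign is plus, so the matching
is an even permutation and only `threeClass` survives. -/
theorem threeClass_of_tri_p_mul (h2 : 2 < p) {k k' : ℕ} (hk : 1 ≤ k ∧ k ≤ (p - 1) / 2)
    (hk' : 1 ≤ k' ∧ k' ≤ (p - 1) / 2) {y y' : ZMod (p ^ 2)}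
    (h : TripleEquiv (tri 1 ((p : ZMod (p ^ 2)) * (k : ZMod (p ^ 2))) y)
      (tri 1 ((p : ZMod (p ^ 2)) * (k' : ZMod (p ^ 2))) y')) :
    k = k' ∧ red p y ∈ threeClass (red p y') := by
  obtain ⟨τ, hs, hc⟩ := tri_invariants h
  obtain ⟨t, ht⟩ := hp.out.odd_of_ne_two (by omega)
  have hs' : (k : ZMod p) = ((τ.sign : ℤ) : ZMod p) * k' := by
    have := (p_mul_eq_p_mul_iff (k : ZMod (p ^ 2)) (((τ.sign : ℤ) : ZMod (p ^ 2)) * k')).1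
      (by linear_combination hs)
    rwa [map_mul, map_intCast, red_natCast, red_natCast] at this
  have hk2 := half_eq_of_eq_or_neg (n := p) (by omega) (by omega)
    ((sign_cases τ).imp (fun h => h.2) id) hs'
  have hsign : τ.sign = 1 := by
    rcases sign_cases τ (n := p) with h | h
    · exact h.1
    · have h1 := hk2.2
      rw [h] at h1
      have : Fact (2 < p) := ⟨h2⟩
      exact absurd h1 ZMod.neg_one_ne_one
  refine ⟨hk2.1, (mem_class_of_perm (τ := τ) ?_).2 hsign⟩
  -- The factor `p` is needed: the third point is off the line by a multiple of `p`, so only `p`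
  -- times the collinearity relation holds.
  have := (hc (fun i => p * ![y' - 1, -y', 1] i) (by simp; ring)
    (by simp only [Matrix.cons_val]; linear_combination (k' : ZMod (p ^ 2)) * p_mul_p (p := p))
    (by simp)).2
  rw [one_mul, mul_assoc, ← mul_add, p_mul_eq_zero_iff, map_add, map_mul, red_vec, red_vec] at this
  exact this

theorem two_mul_half_lt_of_odd {n : ℕ} (h : Odd n) : 2 * (n / 2) < n := by
  obtain ⟨t, rfl⟩ := h; omega

theorem vec_ne_zero {x : ZMod p} (h : x ≠ 0 ∧ x ≠ 1) (i : Fin 3) : ![x - 1, -x, 1] i ≠ 0 := by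
  fin_cases i
  · simpa [sub_eq_zero] using h.2
  · simpa using h.1
  · simp

/-- The right-hand triple has a relation whose coefficients are all `p` times a unit, while on the
left every relation has zero coefficient at the second point. -/
theorem not_tri_one_zero_of_p_mul {s k : ZMod (p ^ 2)} {m : ZMod (p ^ 2)}
    (hm : red p m ≠ 0 ∧ red p m ≠ 1) :
    ¬ TripleEquiv (tri 1 s 0) (tri 1 ((p : ZMod (p ^ 2)) * k) m) := by
  intro h
  obtain ⟨τ, -, hc⟩ := tri_invariants h
  have := (hc (fun i => p * ![m - 1, -m, 1] i) (by simp; ring)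
    (by simp only [Matrix.cons_val]; linear_combination k * p_mul_p (p := p)) (by simp)).2
  rw [one_mul, mul_zero, add_zero, p_mul_eq_zero_iff, red_vec] at this
  exact vec_ne_zero hm _ this

/-- On the right, `p` times any vector of sum zero is a relation. Pulled back to the first two
points on the left, `p • (-1, 1, 0)` would force `p = 0` in `ℤ/p²`. -/
theorem not_tri_one_of_p {m x' y' : ZMod (p ^ 2)} :
    ¬ TripleEquiv (tri 1 0 m) (tri (p : ZMod (p ^ 2)) x' y') := by
  intro h
  obtain ⟨τ, -, hc⟩ := tri_invariants h
  have := (hc (fun i => p * (![-1, 1, 0] (τ.symm i))) ?_ ?_ ?_).2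
  · simp at this
    exact p_ne_zero this
  · have := Equiv.sum_comp τ.symm (![-1, 1, 0] : Fin 3 → ZMod (p ^ 2))
    rw [Fin.sum_univ_three, Fin.sum_univ_three] at this
    rw [← mul_add, ← mul_add, this]; simp
  · linear_combination ![-1, 1, 0] (τ.symm 2) * x' * p_mul_p (p := p)
  · linear_combination (![-1, 1, 0] (τ.symm 1) + ![-1, 1, 0] (τ.symm 2) * y') * p_mul_p (p := p)

/-- The collinear triple on the right has a relation with all coefficients units, but on the left
the coefficient at the third point must vanish mod `p`. -/
theorem not_tri_p {m : ZMod (p ^ 2)} (hm : red p m ≠ 0 ∧ red p m ≠ 1) :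
    ¬ TripleEquiv (tri (p : ZMod (p ^ 2)) 1 0) (tri (p : ZMod (p ^ 2)) 0 m) := by
  intro h
  obtain ⟨τ, -, hc⟩ := tri_invariants h
  have := (hc ![m - 1, -m, 1] (by simp; ring) (by simp) (by simp)).1
  rw [mul_one, mul_comm, p_mul_eq_zero_iff, red_vec] at this
  exact vec_ne_zero hm _ this

theorem not_tri_of_area {q x y q' x' y' : ZMod (p ^ 2)} (h : q * q * x ≠ 0)
    (h' : q' * q' * x' = 0) : ¬ TripleEquiv (tri q x y) (tri q' x' y') := by
  intro e
  obtain ⟨τ, hs, -⟩ := tri_invariants e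
  rw [h', mul_zero] at hs
  exact h hs

theorem isMinOf_six_ne {n s m : ℕ} [NeZero n] (h2 : 2 ≤ s) (hs : s < n)
    (hm : IsMinOf (sixClass (s : ZMod n)) m) : (m : ZMod n) ≠ 0 ∧ (m : ZMod n) ≠ 1 :=
  sixClass_ne (natCast_ne_zero_one h2 hs) hm.cast_mem

theorem isMinOf_three_ne {n s m : ℕ} [NeZero n] (h2 : 2 ≤ s) (hs : s < n)
    (hm : IsMinOf (threeClass (s : ZMod n)) m) : (m : ZMod n) ≠ 0 ∧ (m : ZMod n) ≠ 1 :=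
  sixClass_ne (natCast_ne_zero_one h2 hs) (threeClass_subset_sixClass _ hm.cast_mem)

theorem red_natCast_ne {m : ℕ} (h : (m : ZMod p) ≠ 0 ∧ (m : ZMod p) ≠ 1) :
    red p m ≠ 0 ∧ red p m ≠ 1 := by rwa [red_natCast]

theorem natCast_ne_zero_of_lt {n s : ℕ} (hs : 1 ≤ s) (hn : s < n) : (s : ZMod n) ≠ 0 := by
  rw [Ne, ZMod.natCast_eq_zero_iff]
  exact Nat.not_dvd_of_pos_of_lt hs hn

theorem p_mul_natCast_ne_zero (h2 : 2 < p) {k : ℕ} (hk : 1 ≤ k ∧ k ≤ (p - 1) / 2) :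
    (p : ZMod (p ^ 2)) * (k : ZMod (p ^ 2)) ≠ 0 := by
  rw [Ne, p_mul_eq_zero_iff, red_natCast]
  exact natCast_ne_zero_of_lt hk.1 (by omega)

theorem natCast_sq_ne_zero (h2 : 2 < p) {s : ℕ} (hs : 1 ≤ s ∧ s ≤ p ^ 2 / 2) :
    (s : ZMod (p ^ 2)) ≠ 0 :=
  natCast_ne_zero_of_lt hs.1 (by
    have := two_mul_half_lt_of_odd ((hp.out.odd_of_ne_two (by omega)).pow : Odd (p ^ 2))
    omega)

theorem repLabels_injective (h2 : 2 < p) (i : RepIndex p) : Function.Injective (repLabels i) := by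
  have h10 : (1 : ZMod (p ^ 2)) ≠ 0 := by
    have : Nontrivial (ZMod (p ^ 2)) := ⟨_, _, p_ne_zero⟩
    exact one_ne_zero
  cases i with
  | M s hs =>
    have := natCast_sq_ne_zero h2 hs
    exact tri_injective h10 (by simp [this]) (by simp [this])
  | Nk k m hk hm =>
    have := p_mul_natCast_ne_zero h2 hk
    exact tri_injective h10 (by rw [one_mul]; tauto) (by rw [one_mul]; tauto)
  | N m hm =>
    obtain ⟨s, hs2, hs, hm⟩ := hm
    obtain ⟨h0, h1⟩ := isMinOf_six_ne hs2 hs hm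
    exact tri_injective h10 (by simp [h0]) (by simp [h1])
  | M₀ => exact tri_injective p_ne_zero (by simp [p_ne_zero]) (by simp [p_ne_zero])
  | W m hm =>
    obtain ⟨s, hs2, hs, hm⟩ := hm
    obtain ⟨h0, h1⟩ := red_natCast_ne (isMinOf_six_ne hs2 (by omega) hm)
    refine tri_injective p_ne_zero (fun h => h0 ((p_mul_eq_zero_iff _).1 h.2)) (fun h => h1 ?_)
    rw [(p_mul_eq_p_mul_iff _ 1).1 (h.2.trans (mul_one _).symm), map_one]

theorem repLabels_unique_N (h2 : 2 < p) {s s' : ZMod (p ^ 2)} {m m' : ℕ}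
    (hm : IsMinOf (sixClass s) m) (hm' : IsMinOf (sixClass s') m')
    (h : TripleEquiv (tri (1 : ZMod (p ^ 2)) 0 m) (tri 1 0 m')) : m = m' :=
  eq_of_isMinOf (r := fun x y => TripleEquiv (tri (1 : ZMod (p ^ 2)) 0 x) (tri 1 0 y))
    ⟨fun _ => TripleEquiv.refl _, fun h => h.symm, fun h h' => h.trans h'⟩
    (fun _ _ => ⟨fun h => sixClass_of_tri h.symm, tri_of_mem_sixClass h2⟩) hm hm' h

theorem repLabels_unique_W (h2 : 2 < p) {s s' : ZMod p} {m m' : ℕ}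
    (hm : IsMinOf (sixClass s) m) (hm' : IsMinOf (sixClass s') m')
    (h : TripleEquiv (tri (p : ZMod (p ^ 2)) 0 m) (tri p 0 m')) : m = m' := by
  -- Residues mod `p` are compared through their standard lifts, since the minima live in `ℤ/p` and
  -- the labels in `ℤ/p²`.
  refine eq_of_isMinOf (r := fun x y : ZMod p => TripleEquiv
    (tri (p : ZMod (p ^ 2)) 0 (x.val : ZMod (p ^ 2))) (tri p 0 (y.val : ZMod (p ^ 2))))
    ⟨fun _ => TripleEquiv.refl _, fun h => h.symm, fun h h' => h.trans h'⟩
    (fun x y => ⟨fun h => ?_, fun h => tri_of_red_mem_sixClass h2 ?_⟩) hm hm' ?_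
  · simpa [red_natCast] using sixClass_of_tri_p h.symm
  · simpa [red_natCast] using h
  · rwa [ZMod.val_cast_of_lt hm.lt, ZMod.val_cast_of_lt hm'.lt]

theorem repLabels_unique_Nk (h2 : 2 < p) {k : ℕ} (hk : 1 ≤ k ∧ k ≤ (p - 1) / 2) {s s' : ZMod p}
    {m m' : ℕ} (hm : IsMinOf (threeClass s) m) (hm' : IsMinOf (threeClass s') m')
    (h : TripleEquiv (tri 1 ((p : ZMod (p ^ 2)) * (k : ZMod (p ^ 2))) m)
      (tri 1 ((p : ZMod (p ^ 2)) * (k : ZMod (p ^ 2))) m')) : m = m' := by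
  refine eq_of_isMinOf (r := fun x y : ZMod p => TripleEquiv
    (tri 1 ((p : ZMod (p ^ 2)) * (k : ZMod (p ^ 2))) (x.val : ZMod (p ^ 2)))
    (tri 1 ((p : ZMod (p ^ 2)) * (k : ZMod (p ^ 2))) (y.val : ZMod (p ^ 2))))
    ⟨fun _ => TripleEquiv.refl _, fun h => h.symm, fun h h' => h.trans h'⟩
    (fun x y => ⟨fun h => ?_, fun h => tri_of_red_mem_threeClass h2 ?_ ?_⟩) hm hm' ?_
  · simpa [red_natCast] using (threeClass_of_tri_p_mul h2 hk hk h.symm).2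
  · rw [red_natCast]
    exact natCast_ne_zero_of_lt hk.1 (by omega)
  · simpa [red_natCast] using h
  · rwa [ZMod.val_cast_of_lt hm.lt, ZMod.val_cast_of_lt hm'.lt]

theorem repLabels_unique (h2 : 2 < p) {i j : RepIndex p}
    (h : TripleEquiv (repLabels i) (repLabels j)) : i = j := by
  have hM {s k m : ℕ} (hs : 1 ≤ s ∧ s ≤ p ^ 2 / 2) (hk) (hm) :
      ¬ TripleEquiv (repLabels (.M s hs)) (repLabels (p := p) (.Nk k m hk hm)) := by
    obtain ⟨t, ht2, ht, hm⟩ := hm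
    exact not_tri_one_zero_of_p_mul (red_natCast_ne (isMinOf_three_ne ht2 (by omega) hm))
  have hW {m : ℕ} (hm) : ¬ TripleEquiv (repLabels .M₀) (repLabels (p := p) (.W m hm)) := by
    obtain ⟨t, ht2, ht, hm⟩ := hm
    exact not_tri_p (red_natCast_ne (isMinOf_six_ne ht2 (by omega) hm))
  -- The areas of `M` and `Nk` are nonzero, whereas `N`, `M₀` and `W` have area zero; this settles
  -- every comparison between the two groups.
  have hsM {s : ℕ} (hs : 1 ≤ s ∧ s ≤ p ^ 2 / 2) :
      (1 : ZMod (p ^ 2)) * 1 * (s : ZMod (p ^ 2)) ≠ 0 := by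
    rw [one_mul, one_mul]; exact natCast_sq_ne_zero h2 hs
  have hsN {k : ℕ} (hk : 1 ≤ k ∧ k ≤ (p - 1) / 2) :
      (1 : ZMod (p ^ 2)) * 1 * ((p : ZMod (p ^ 2)) * (k : ZMod (p ^ 2))) ≠ 0 := by
    rw [one_mul, one_mul]; exact p_mul_natCast_ne_zero h2 hk
  have hpp : (p : ZMod (p ^ 2)) * p * 1 = 0 := by rw [p_mul_p, zero_mul]
  cases i with
  | M s hs =>
    cases j with
    | M s' hs' =>
      obtain ⟨τ, e, -⟩ := tri_invariants h
      rw [one_mul, one_mul, one_mul] at e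
      have := two_mul_half_lt_of_odd ((hp.out.odd_of_ne_two (by omega)).pow : Odd (p ^ 2))
      obtain ⟨rfl, -⟩ := half_eq_of_eq_or_neg (n := p ^ 2) (by omega) (by omega)
        ((sign_cases τ).imp (fun h => h.2) id) e
      rfl
    | Nk k m hk hm => exact absurd h (hM _ _ _)
    | N m hm => exact absurd h (not_tri_of_area (hsM hs) (mul_zero _))
    | M₀ => exact absurd h (not_tri_of_area (hsM hs) hpp)
    | W m hm => exact absurd h (not_tri_of_area (hsM hs) (mul_zero _))
  | Nk k m hk hm =>
    cases j with
    | M s' hs' => exact absurd h.symm (hM _ _ _)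
    | Nk k' m' hk' hm' =>
      obtain ⟨rfl, -⟩ := threeClass_of_tri_p_mul h2 hk hk' h
      have hm₁ := hm
      have hm₁' := hm'
      obtain ⟨_, _, _, hm₁⟩ := hm₁
      obtain ⟨_, _, _, hm₁'⟩ := hm₁'
      obtain rfl := repLabels_unique_Nk h2 hk hm₁ hm₁' h
      rfl
    | N m hm => exact absurd h (not_tri_of_area (hsN hk) (mul_zero _))
    | M₀ => exact absurd h (not_tri_of_area (hsN hk) hpp)
    | W m hm => exact absurd h (not_tri_of_area (hsN hk) (mul_zero _))
  | N m hm =>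
    cases j with
    | M s hs => exact absurd h.symm (not_tri_of_area (hsM hs) (mul_zero _))
    | Nk k m hk hm => exact absurd h.symm (not_tri_of_area (hsN hk) (mul_zero _))
    | N m' hm' =>
      have hm₁ := hm
      have hm₁' := hm'
      obtain ⟨_, _, _, hm₁⟩ := hm₁
      obtain ⟨_, _, _, hm₁'⟩ := hm₁'
      obtain rfl := repLabels_unique_N h2 hm₁ hm₁' h
      rfl
    | M₀ => exact absurd h not_tri_one_of_p
    | W m hm => exact absurd h not_tri_one_of_p
  | M₀ =>
    cases j with
    | M s hs => exact absurd h.symm (not_tri_of_area (hsM hs) hpp)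
    | Nk k m hk hm => exact absurd h.symm (not_tri_of_area (hsN hk) hpp)
    | N m hm => exact absurd h.symm not_tri_one_of_p
    | M₀ => rfl
    | W m hm => exact absurd h (hW _)
  | W m hm =>
    cases j with
    | M s hs => exact absurd h.symm (not_tri_of_area (hsM hs) (mul_zero _))
    | Nk k m hk hm => exact absurd h.symm (not_tri_of_area (hsN hk) (mul_zero _))
    | N m hm => exact absurd h.symm not_tri_one_of_p
    | M₀ => exact absurd h.symm (hW _)
    | W m' hm' =>
      have hm₁ := hm
      have hm₁' := hm'
      obtain ⟨_, _, _, hm₁⟩ := hm₁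
      obtain ⟨_, _, _, hm₁'⟩ := hm₁'
      obtain rfl := repLabels_unique_W h2 hm₁ hm₁' h
      rfl

theorem isGPMTriple_rep (h2 : 2 < p) (i : RepIndex p) : IsGPMTriple (p ^ 2) (rep p i) := by
  rw [rep_eq_range]
  exact isGPMTriple_range (repLabels_injective h2 i)

theorem existsUnique_rep (h2 : 2 < p) {T : Set (Mat (p ^ 2))} (hT : IsGPMTriple (p ^ 2) T) :
    ∃! i : RepIndex p, UEquiv T (rep p i) := by
  obtain ⟨v, hv, rfl⟩ := hT.exists_range
  have key (i : RepIndex p) : UEquiv (Set.range fun j => weyl (v j)) (rep p i) ↔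
      TripleEquiv v (repLabels i) := by
    rw [rep_eq_range, uEquiv_range_iff hv (repLabels_injective h2 i)]
  simp only [key]
  obtain ⟨i, hi⟩ := exists_repLabels h2 hv
  exact ⟨i, hi, fun j hj => repLabels_unique h2 (hj.symm.trans hi)⟩

end uniqueness

/-! ### The action of `S₃` on cross-ratio parameters and Burnside's lemma. -/

section action

variable {n : ℕ}

/-- The coefficients of the affine relation between `0, 1, x`. -/
def relVec (x : ZMod n) : Fin 3 → ZMod n := ![x - 1, -x, 1]

theorem relVec_sum (x : ZMod n) : ∑ i, relVec x i = 0 := by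
  rw [Fin.sum_univ_three]; simp [relVec]; ring

/-- The elements `x` for which `x` and `1 - x` are invertible. -/
abbrev UnitPair (n : ℕ) : Type := {x : ZMod n // IsUnit x ∧ IsUnit (1 - x)}

theorem isUnit_relVec (x : UnitPair n) (i : Fin 3) : IsUnit (relVec x.1 i) := by
  fin_cases i
  · have := x.2.2.neg
    rw [neg_sub] at this
    exact this
  · exact x.2.1.neg
  · exact isUnit_one

/-- All three coefficients are units, so after permutation the vector can be rescaled to have last
entry 1; because its entries sum to zero it is again some `relVec y`. -/
theorem existsUnique_perm_smul (τ : Equiv.Perm (Fin 3)) (x : UnitPair n) :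
    ∃! y : UnitPair n, relVec x.1 (τ⁻¹ 1) + relVec x.1 (τ⁻¹ 2) * y.1 = 0 := by
  obtain ⟨u, hu⟩ := (isUnit_relVec x (τ⁻¹ 2)).exists_right_inv
  have huu : IsUnit u := IsUnit.of_mul_eq_one _ ((mul_comm _ _).trans hu)
  have hsum := relVec_sum x.1
  rw [← Equiv.sum_comp τ⁻¹, Fin.sum_univ_three] at hsum
  refine ⟨⟨-(u * relVec x.1 (τ⁻¹ 1)), (huu.mul (isUnit_relVec x _)).neg, ?_⟩, ?_, ?_⟩
  · have : 1 - -(u * relVec x.1 (τ⁻¹ 1)) = -(u * relVec x.1 (τ⁻¹ 0)) := by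
      linear_combination u * hsum - hu
    rw [this]
    exact (huu.mul (isUnit_relVec x _)).neg
  · simp only; linear_combination -relVec x.1 (τ⁻¹ 1) * hu
  · intro y hy
    ext
    simp only
    linear_combination u * hy - y.1 * hu

/-- The action of the symmetric group by `x ↦ x⁻¹`, `x ↦ 1 - x`. -/
instance permAction : MulAction (Equiv.Perm (Fin 3)) (UnitPair n) where
  smul τ x := (existsUnique_perm_smul τ x).choose
  one_smul x := by
    have h : relVec x.1 1 + relVec x.1 2 * x.1 = 0 := by simp [relVec]
    exact ((existsUnique_perm_smul 1 x).choose_spec.2 x h).symm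
  mul_smul σ τ x := by
    set y := (existsUnique_perm_smul τ x).choose with hy
    set z := (existsUnique_perm_smul σ y).choose with hz
    have h1 : relVec x.1 (τ⁻¹ 1) + relVec x.1 (τ⁻¹ 2) * y.1 = 0 :=
      (existsUnique_perm_smul τ x).choose_spec.1
    have h2 : relVec y.1 (σ⁻¹ 1) + relVec y.1 (σ⁻¹ 2) * z.1 = 0 :=
      (existsUnique_perm_smul σ y).choose_spec.1
    have hsum := relVec_sum x.1
    rw [← Equiv.sum_comp τ⁻¹, Fin.sum_univ_three] at hsum
    -- The relation vector of `y` is the permuted relation vector of `x` up to scale, so composition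
    -- of the action is composition of permutations.
    have hv (i : Fin 3) : relVec x.1 (τ⁻¹ i) = relVec x.1 (τ⁻¹ 2) * relVec y.1 i := by
      fin_cases i
      · change relVec x.1 (τ⁻¹ 0) = relVec x.1 (τ⁻¹ 2) * (y.1 - 1)
        linear_combination hsum - h1
      · change relVec x.1 (τ⁻¹ 1) = relVec x.1 (τ⁻¹ 2) * (-y.1)
        linear_combination h1
      · exact (mul_one _).symm
    refine ((existsUnique_perm_smul (σ * τ) x).choose_spec.2 z ?_).symm
    rw [mul_inv_rev, Equiv.Perm.mul_apply, Equiv.Perm.mul_apply, hv, hv (σ⁻¹ 2)]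
    linear_combination relVec x.1 (τ⁻¹ 2) * h2

theorem smul_eq_iff (τ : Equiv.Perm (Fin 3)) (x y : UnitPair n) :
    τ • x = y ↔ relVec x.1 (τ⁻¹ 1) + relVec x.1 (τ⁻¹ 2) * y.1 = 0 := by
  constructor
  · rintro rfl
    exact (existsUnique_perm_smul τ x).choose_spec.1
  · exact fun h => ((existsUnique_perm_smul τ x).choose_spec.2 y h).symm

theorem exists_smul_one_sub (x : UnitPair n) :
    ∃ y : UnitPair n, y.1 = 1 - x.1 ∧ ∃ τ : Equiv.Perm (Fin 3), τ • x = y := by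
  refine ⟨⟨1 - x.1, x.2.2, by simpa using x.2.1⟩, rfl, Equiv.swap 0 1, ?_⟩
  rw [smul_eq_iff]
  simp [relVec, Equiv.swap_apply_of_ne_of_ne]

theorem exists_smul_one_sub_inv (x : UnitPair n) {u : ZMod n} (hu : x.1 * u = 1) :
    ∃ y : UnitPair n, y.1 = 1 - u ∧ ∃ τ : alternatingGroup (Fin 3), τ • x = y := by
  have huu : IsUnit u := IsUnit.of_mul_eq_one _ ((mul_comm _ _).trans hu)
  have hy : 1 - u = -(u * (1 - x.1)) := by linear_combination -hu
  refine ⟨⟨1 - u, ?_, by simpa using huu⟩, rfl, ⟨finRotate 3, Equiv.Perm.mem_alternatingGroup.2 (by decide)⟩, ?_⟩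
  · rw [hy]; exact (huu.mul x.2.2).neg
  · change finRotate 3 • x = _
    rw [smul_eq_iff]
    have h1 : (finRotate 3)⁻¹ 1 = 0 := by decide
    have h2 : (finRotate 3)⁻¹ 2 = 1 := by decide
    simp only [h1, h2, relVec, Matrix.cons_val]
    linear_combination hu

theorem mem_sixClass_iff_orbitRel (x : UnitPair n) (y : ZMod n) :
    y ∈ sixClass x.1 ↔
      ∃ hy, MulAction.orbitRel (Equiv.Perm (Fin 3)) (UnitPair n) x ⟨y, hy⟩ := by
  constructor
  · intro h
    refine rel_of_mem_sixClass (r := fun x y => ∀ hx, ∃ hy,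
      MulAction.orbitRel (Equiv.Perm (Fin 3)) (UnitPair n) ⟨x, hx⟩ ⟨y, hy⟩) ?_ ?_ ?_ ?_ h x.2
    · exact fun y hy => ⟨hy, Setoid.refl' _ _⟩
    · intro a b c hab hbc ha
      obtain ⟨hb, h1⟩ := hab ha
      obtain ⟨hc, h2⟩ := hbc hb
      exact ⟨hc, Setoid.trans' _ h1 h2⟩
    · intro y hy
      obtain ⟨⟨_, hz⟩, rfl, τ, h⟩ := exists_smul_one_sub ⟨y, hy⟩
      exact ⟨hz, Setoid.symm' _ ⟨τ, h⟩⟩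
    · intro y u hu hy
      obtain ⟨⟨_, hz⟩, rfl, τ, h⟩ := exists_smul_one_sub_inv ⟨y, hy⟩ hu
      exact ⟨hz, Setoid.symm' _ ⟨τ.1, h⟩⟩
  · rintro ⟨hy, h⟩
    obtain ⟨τ, h⟩ := Setoid.symm' _ h
    exact (mem_class_of_perm ((smul_eq_iff τ x _).1 h)).1

theorem mem_threeClass_iff_orbitRel (x : UnitPair n) (y : ZMod n) :
    y ∈ threeClass x.1 ↔
      ∃ hy, MulAction.orbitRel (alternatingGroup (Fin 3)) (UnitPair n) x ⟨y, hy⟩ := by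
  constructor
  · intro h
    refine (rel_of_mem_threeClass (r := fun x y => (IsUnit x ∧ IsUnit (1 - x)) ∨
      (IsUnit y ∧ IsUnit (1 - y)) → ∃ hx hy,
      MulAction.orbitRel (alternatingGroup (Fin 3)) (UnitPair n) ⟨x, hx⟩ ⟨y, hy⟩) ?_ ?_ ?_ h
      (Or.inl x.2)).2
    · exact fun y hy => ⟨or_self_iff.1 hy, or_self_iff.1 hy, Setoid.refl' _ _⟩
    · intro a b hab h
      obtain ⟨ha, hb, h1⟩ := hab h.symm
      exact ⟨hb, ha, Setoid.symm' _ h1⟩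
    · intro y u hu hy
      have hy : IsUnit y ∧ IsUnit (1 - y) := by
        refine hy.elim id fun h => ⟨IsUnit.of_mul_eq_one _ hu, ?_⟩
        have : 1 - y = -(y * (1 - u)) := by linear_combination -hu
        rw [this]
        exact ((IsUnit.of_mul_eq_one _ hu).mul h.1).neg
      obtain ⟨⟨_, hz⟩, rfl, τ, h⟩ := exists_smul_one_sub_inv ⟨y, hy⟩ hu
      exact ⟨hy, hz, Setoid.symm' _ ⟨τ, h⟩⟩
  · rintro ⟨hy, h⟩
    obtain ⟨τ, h⟩ := Setoid.symm' _ h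
    refine (mem_class_of_perm ((smul_eq_iff τ.1 x _).1 h)).2 ?_
    rw [Equiv.Perm.sign_inv]
    exact τ.2

/-- Each class has exactly one minimum, and that minimum is itself in the class. -/
theorem card_minima_eq_card_quotient [NeZero n] (s : Setoid (UnitPair n))
    {C : ZMod n → Set (ZMod n)} (hC : ∀ (x : UnitPair n) y, y ∈ C x.1 ↔ ∃ hy, s x ⟨y, hy⟩) :
    Nat.card {m : ℕ // ∃ x : UnitPair n, IsMinOf (C x.1) m} = Nat.card (Quotient s) := by
  have hmem (m : {m : ℕ // ∃ x : UnitPair n, IsMinOf (C x.1) m}) :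
      ∃ z : UnitPair n, z.1 = (m.1 : ZMod n) ∧ IsMinOf (C z.1) m.1 := by
    obtain ⟨m, x, hx⟩ := m
    obtain ⟨hy, h⟩ := (hC x m).1 hx.cast_mem
    refine ⟨⟨m, hy⟩, rfl, ?_⟩
    have : C (m : ZMod n) = C x.1 := by
      ext w
      rw [hC ⟨m, hy⟩, hC x]
      exact exists_congr fun hw => ⟨fun h' => s.trans h h', fun h' => s.trans (s.symm h) h'⟩
    simpa [this] using hx
  choose z hz hmin using hmem
  refine Nat.card_congr (Equiv.ofBijective (fun m => Quotient.mk s (z m)) ⟨?_, ?_⟩)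
  · intro m m' h
    have h := Quotient.exact h
    have e1 : z m' ∈ {w : UnitPair n | w.1 ∈ C (z m).1} := (hC _ _).2 ⟨(z m').2, h⟩
    have e2 : z m ∈ {w : UnitPair n | w.1 ∈ C (z m').1} := (hC _ _).2 ⟨(z m).2, s.symm h⟩
    rw [Set.mem_ofPred_eq, hz m'] at e1
    rw [Set.mem_ofPred_eq, hz m] at e2
    exact Subtype.ext (le_antisymm ((hmin m).le_of_mem (hmin m').lt e1)
      ((hmin m').le_of_mem (hmin m).lt e2))
  · intro q
    induction q using Quotient.ind with
    | _ x =>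
      obtain ⟨m, hm, hm'⟩ := exists_isMinOf (S := C x.1) ⟨x.1, (hC _ _).2 ⟨x.2, s.refl _⟩⟩
      refine ⟨⟨m, x, hm⟩, Quotient.sound ?_⟩
      obtain ⟨hy, h⟩ := (hC x _).1 hm'
      have : z ⟨m, x, hm⟩ = ⟨m, hy⟩ := Subtype.ext (hz _)
      rw [this]
      exact s.symm h

/-- The transpositions are `x ↦ x⁻¹`, `1 - x` and `x (x - 1)⁻¹`, with unique fixed points `-1`,
`1/2` and `2`: the other candidate for a fixed point is excluded because `x` and `1 - x` are units.
Both 3-cycles fix the roots of `x² - x + 1`. -/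
theorem card_fixedBy [NeZero n] (h2 : IsUnit (2 : ZMod n)) (τ : Equiv.Perm (Fin 3)) :
    Nat.card (MulAction.fixedBy (UnitPair n) τ) =
      if τ = 1 then Nat.card (UnitPair n) else if τ.sign = 1 then
        Nat.card {x : UnitPair n // x.1 ^ 2 - x.1 + 1 = 0} else 1 := by
  have hfix (x : UnitPair n) : x ∈ MulAction.fixedBy (UnitPair n) τ ↔
      relVec x.1 (τ⁻¹ 1) + relVec x.1 (τ⁻¹ 2) * x.1 = 0 := by
    rw [MulAction.mem_fixedBy, smul_eq_iff]
  have key (P : UnitPair n → Prop)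
      (hP : ∀ x : UnitPair n, relVec x.1 (τ⁻¹ 1) + relVec x.1 (τ⁻¹ 2) * x.1 = 0 ↔ P x) :
      Nat.card (MulAction.fixedBy (UnitPair n) τ) = Nat.card {x // P x} :=
    Nat.card_congr (Equiv.subtypeEquivRight fun x => (hfix x).trans (hP x))
  have hone (z : UnitPair n) : Nat.card {x // x = z} = 1 := by simp
  obtain ⟨h, hh⟩ := h2.exists_right_inv
  have hhu : IsUnit h := IsUnit.of_mul_eq_one _ ((mul_comm _ _).trans hh)
  have hs : (τ⁻¹).sign = τ.sign := Equiv.Perm.sign_inv τ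
  by_cases h1 : τ = 1
  · rw [if_pos h1]
    subst h1
    rw [key (fun _ => True) (fun x => by simp [relVec])]
    exact Nat.card_congr (Equiv.subtypeUnivEquiv fun _ => trivial)
  rw [if_neg h1]
  rcases perm_fin_three τ⁻¹ with ⟨e0, e1, e2, e⟩ | ⟨e0, e1, e2, e⟩ | ⟨e0, e1, e2, e⟩ |
    ⟨e0, e1, e2, e⟩ | ⟨e0, e1, e2, e⟩ | ⟨e0, e1, e2, e⟩
  · refine absurd (inv_eq_one.1 (Equiv.ext fun i => ?_)) h1
    fin_cases i <;> assumption
  · rw [if_pos (hs ▸ e)]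
    refine key _ fun x => ?_
    simp only [e1, e2, relVec, Matrix.cons_val]
    constructor <;> intro hx <;> linear_combination hx
  · rw [if_pos (hs ▸ e)]
    refine key _ fun x => ?_
    simp only [e1, e2, relVec, Matrix.cons_val]
    constructor <;> intro hx <;> linear_combination -hx
  · rw [if_neg (by rw [← hs, e]; decide), key (fun x => x = ⟨-1, isUnit_one.neg, by
      rw [sub_neg_eq_add, one_add_one_eq_two]; exact h2⟩) fun x => ?_, hone]
    simp only [e1, e2, relVec, Matrix.cons_val, Subtype.ext_iff]
    refine ⟨fun hx => ?_, fun hx => by rw [hx]; ring⟩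
    exact x.2.2.mul_left_cancel (by linear_combination hx)
  · rw [if_neg (by rw [← hs, e]; decide), key (fun x => x = ⟨h, hhu, by
      have : 1 - h = h := by linear_combination -hh
      rwa [this]⟩) fun x => ?_, hone]
    simp only [e1, e2, relVec, Matrix.cons_val, Subtype.ext_iff]
    refine ⟨fun hx => ?_, fun hx => by rw [hx]; linear_combination hh⟩
    linear_combination h * hx - (x.1) * hh
  · rw [if_neg (by rw [← hs, e]; decide), key (fun x => x = ⟨2, h2, by
      have : (1 - 2 : ZMod n) = -1 := by ring
      rw [this]; exact isUnit_one.neg⟩) fun x => ?_, hone]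
    simp only [e1, e2, relVec, Matrix.cons_val, Subtype.ext_iff]
    refine ⟨fun hx => ?_, fun hx => by rw [hx]; ring⟩
    exact x.2.1.mul_left_cancel (by linear_combination hx)

theorem six_mul_card_minima [NeZero n] (h2 : IsUnit (2 : ZMod n)) :
    6 * Nat.card {m : ℕ // ∃ x : UnitPair n, IsMinOf (sixClass x.1) m} =
      Nat.card (UnitPair n) + 3 + 2 * Nat.card {x : UnitPair n // x.1 ^ 2 - x.1 + 1 = 0} := by
  classical
  have hb := MulAction.sum_card_fixedBy_eq_card_orbits_mul_card_group (Equiv.Perm (Fin 3))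
    (UnitPair n)
  simp only [← Nat.card_eq_fintype_card, card_fixedBy h2] at hb
  have hc : Nat.card (Equiv.Perm (Fin 3)) = 6 := by
    rw [Nat.card_eq_fintype_card]; decide
  have hs (N r : ℕ) : (∑ τ : Equiv.Perm (Fin 3),
      if τ = 1 then N else if τ.sign = 1 then r else 1) = N + 3 + 2 * r := by
    have hu : (Finset.univ : Finset (Equiv.Perm (Fin 3))) = {1, finRotate 3, (finRotate 3)⁻¹,
      Equiv.swap 0 1, Equiv.swap 0 2, Equiv.swap 1 2} := by decide
    rw [hu]
    simp +decide
    ring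
  rw [hs, hc] at hb
  rw [card_minima_eq_card_quotient _ mem_sixClass_iff_orbitRel, hb, mul_comm]

theorem three_mul_card_minima [NeZero n] (h2 : IsUnit (2 : ZMod n)) :
    3 * Nat.card {m : ℕ // ∃ x : UnitPair n, IsMinOf (threeClass x.1) m} =
      Nat.card (UnitPair n) + 2 * Nat.card {x : UnitPair n // x.1 ^ 2 - x.1 + 1 = 0} := by
  classical
  have hb := MulAction.sum_card_fixedBy_eq_card_orbits_mul_card_group (alternatingGroup (Fin 3))
    (UnitPair n)
  have hf (τ : alternatingGroup (Fin 3)) : Nat.card (MulAction.fixedBy (UnitPair n) τ) =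
      if τ.1 = 1 then Nat.card (UnitPair n) else
        Nat.card {x : UnitPair n // x.1 ^ 2 - x.1 + 1 = 0} := by
    have h := card_fixedBy (n := n) h2 τ.1
    rw [if_pos (Equiv.Perm.mem_alternatingGroup.1 τ.2)] at h
    exact h
  simp only [← Nat.card_eq_fintype_card, hf] at hb
  have hs (N r : ℕ) : (∑ τ : alternatingGroup (Fin 3), if τ.1 = 1 then N else r) = N + 2 * r := by
    have hmem : ∀ τ : Equiv.Perm (Fin 3),
        τ ∈ ({1, finRotate 3, (finRotate 3)⁻¹} : Finset _) ↔ τ.sign = 1 := by decide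
    refine (Finset.sum_subtype {1, finRotate 3, (finRotate 3)⁻¹}
      (fun τ => (hmem τ).trans Equiv.Perm.mem_alternatingGroup.symm)
      (fun τ => if τ = 1 then N else r)).symm.trans ?_
    simp +decide
    ring
  have hc : Nat.card (alternatingGroup (Fin 3)) = 3 := by
    rw [nat_card_alternatingGroup]; simp; decide
  rw [hs, hc] at hb
  rw [card_minima_eq_card_quotient _ mem_threeClass_iff_orbitRel, hb, mul_comm]

end action

/-! ### Counting the parameters modulo `p` and modulo `p²`. -/

section counting

variable {p : ℕ} [hp : Fact p.Prime]

theorem card_roots_le_two {n : ℕ} [NeZero n]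
    (h : ∀ x y : ZMod n, x ^ 2 - x + 1 = 0 → y ^ 2 - y + 1 = 0 → y = x ∨ y = 1 - x) :
    Nat.card {x : UnitPair n // x.1 ^ 2 - x.1 + 1 = 0} ≤ 2 := by
  rcases isEmpty_or_nonempty {x : UnitPair n // x.1 ^ 2 - x.1 + 1 = 0} with he | ⟨⟨x, hx⟩⟩
  · simp
  · have hsub : Function.Injective
        (fun y : {x : UnitPair n // x.1 ^ 2 - x.1 + 1 = 0} =>
          (⟨y.1.1, h x.1 y.1.1 hx y.2⟩ : ({x.1, 1 - x.1} : Set (ZMod n)))) := by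
      intro y z e
      exact Subtype.ext (Subtype.ext (congrArg (fun t => t.1) e :))
    refine (Nat.card_le_card_of_injective _ hsub).trans ?_
    rw [Nat.card_coe_set_eq]
    exact (Set.ncard_insert_le _ _).trans (by rw [Set.ncard_singleton])

theorem isUnit_two_prime (h2 : 2 < p) : IsUnit (2 : ZMod p) := by
  rw [← map_ofNat (red p) 2]
  exact (isUnit_two h2).map (red p)

theorem roots_prime (x y : ZMod p) (hx : x ^ 2 - x + 1 = 0) (hy : y ^ 2 - y + 1 = 0) :
    y = x ∨ y = 1 - x := by
  have : (y - x) * (y - (1 - x)) = 0 := by linear_combination hy - hx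
  exact (mul_eq_zero.1 this).imp sub_eq_zero.1 sub_eq_zero.1

/-- A product of two nonunits may vanish here. In that case `2x - 1` is zero mod `p`, and `4(x² - x
+ 1) = (2x - 1)² + 3` forces `p = 3`; modulo 9 there is no root. -/
theorem roots_prime_sq (x y : ZMod (p ^ 2)) (hx : x ^ 2 - x + 1 = 0)
    (hy : y ^ 2 - y + 1 = 0) : y = x ∨ y = 1 - x := by
  have h : (y - x) * (y - (1 - x)) = 0 := by linear_combination hy - hx
  by_cases h1 : IsUnit (y - x)
  · exact Or.inr (sub_eq_zero.1 ((h1.mul_right_eq_zero).1 h))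
  by_cases h2 : IsUnit (y - (1 - x))
  · exact Or.inl (sub_eq_zero.1 ((h2.mul_left_eq_zero).1 h))
  rw [isUnit_iff_red, not_not] at h1 h2
  have hx' := congrArg (red p) hx
  simp only [map_sub, map_add, map_pow, map_one, map_zero] at h1 h2 hx'
  have h3 : ((3 : ℕ) : ZMod p) = 0 := by
    push_cast
    linear_combination 4 * hx' - (h2 - h1) * (2 * red p x - 1)
  rw [ZMod.natCast_eq_zero_iff, Nat.prime_dvd_prime_iff_eq hp.out Nat.prime_three] at h3
  subst h3
  have key : ∀ x : ZMod 9, x ^ 2 - x + 1 ≠ 0 := by decide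
  exact absurd hx (key x)

theorem card_unitPair_prime : Nat.card (UnitPair p) = p - 2 := by
  have e : Nat.card (UnitPair p) = ({0, 1} : Set (ZMod p))ᶜ.ncard := by
    rw [← Nat.card_coe_set_eq]
    refine Nat.card_congr (Equiv.subtypeEquivRight fun x => ?_)
    rw [isUnit_iff_ne_zero, isUnit_iff_ne_zero, sub_ne_zero]
    simp [eq_comm]
  rw [e, Set.ncard_compl, Set.ncard_pair zero_ne_one]
  simp

/-- The fibre over a residue is `a + p b` with `b` running over `ℤ/p`. -/
theorem ncard_red_eq (a : ZMod (p ^ 2)) : {x : ZMod (p ^ 2) | red p x = red p a}.ncard = p := by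
  have e : {x : ZMod (p ^ 2) | red p x = red p a} =
      Set.range fun b : ZMod p => a + (p : ZMod (p ^ 2)) * (b.val : ZMod (p ^ 2)) := by
    ext x
    constructor
    · intro hx
      obtain ⟨c, hc⟩ := (red_eq_zero_iff (x - a)).1 (by rw [map_sub, sub_eq_zero]; exact hx)
      refine ⟨red p c, ?_⟩
      have := (p_mul_eq_p_mul_iff _ _).2 (red_residue c)
      simp only [residue] at this
      simp only [this]
      linear_combination -hc
    · rintro ⟨b, rfl⟩
      simp
  have hinj : Function.Injective
      fun b : ZMod p => a + (p : ZMod (p ^ 2)) * (b.val : ZMod (p ^ 2)) := by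
    intro b b' h
    have := (p_mul_eq_p_mul_iff _ _).1 (add_left_cancel h)
    simpa [red_natCast] using this
  rw [e, ← Set.image_univ, Set.ncard_image_of_injective _ hinj]
  simp

theorem card_unitPair_prime_sq : Nat.card (UnitPair (p ^ 2)) = p ^ 2 - 2 * p := by
  have e : Nat.card (UnitPair (p ^ 2)) = ({x : ZMod (p ^ 2) | red p x = red p 0} ∪
      {x : ZMod (p ^ 2) | red p x = red p 1})ᶜ.ncard := by
    rw [← Nat.card_coe_set_eq]
    refine Nat.card_congr (Equiv.subtypeEquivRight fun x => ?_)
    rw [isUnit_iff_red, isUnit_iff_red, map_sub, sub_ne_zero]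
    simp [eq_comm]
  rw [e, Set.ncard_compl, Set.ncard_union_eq, ncard_red_eq, ncard_red_eq, Nat.card_zmod, two_mul]
  rw [Set.disjoint_left]
  intro x h0 h1
  have := h0.symm.trans h1
  simp at this

theorem prime_mod_six (h2 : 2 < p) : p = 3 ∨ p % 6 = 1 ∨ p % 6 = 5 := by
  have h3 : p = 3 ∨ p % 3 ≠ 0 := by
    by_cases h : p % 3 = 0
    · exact Or.inl ((Nat.prime_dvd_prime_iff_eq Nat.prime_three hp.out).1
        (Nat.dvd_of_mod_eq_zero h)).symm
    · exact Or.inr h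
  obtain ⟨t, ht⟩ := hp.out.odd_of_ne_two (by omega)
  omega

theorem exists_unitPair_prime_iff (C : ZMod p → Set (ZMod p)) (m : ℕ) :
    (∃ s : ℕ, 2 ≤ s ∧ s ≤ p - 1 ∧ IsMinOf (C (s : ZMod p)) m) ↔
      ∃ x : UnitPair p, IsMinOf (C x.1) m := by
  have h2 := hp.out.two_le
  constructor
  · rintro ⟨s, hs2, hs, h⟩
    obtain ⟨h0, h1⟩ := natCast_ne_zero_one (n := p) hs2 (by omega)
    exact ⟨⟨s, isUnit_iff_ne_zero.2 h0, isUnit_iff_ne_zero.2 (sub_ne_zero.2 h1.symm)⟩, h⟩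
  · rintro ⟨⟨x, h0, h1⟩, h⟩
    refine ⟨x.val, two_le_val h2 h0.ne_zero (sub_ne_zero.1 h1.ne_zero).symm, ?_, ?_⟩
    · have := ZMod.val_lt x; omega
    · rwa [ZMod.natCast_zmod_val]

theorem card_six_prime (h2 : 2 < p) :
    Nat.card {m : ℕ // ∃ s : ℕ, 2 ≤ s ∧ s ≤ p - 1 ∧ IsMinOf (sixClass (s : ZMod p)) m}
      = p / 6 + 1 := by
  have h := six_mul_card_minima (isUnit_two_prime h2)
  have hr := card_roots_le_two (roots_prime (p := p))
  rw [card_unitPair_prime] at h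
  simp only [exists_unitPair_prime_iff]
  have := prime_mod_six h2
  -- The number of roots lies in `{0, 1, 2}`, and divisibility by 6 determines it from `p` mod 6, so
  -- the roots need not be found.
  omega

theorem card_three_prime (h2 : 2 < p) :
    Nat.card {m : ℕ // ∃ s : ℕ, 2 ≤ s ∧ s ≤ p - 1 ∧ IsMinOf (threeClass (s : ZMod p)) m}
      = 2 * (p / 6) + 1 := by
  have h := three_mul_card_minima (isUnit_two_prime h2)
  have hr := card_roots_le_two (roots_prime (p := p))
  rw [card_unitPair_prime] at h
  simp only [exists_unitPair_prime_iff]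
  have := prime_mod_six h2
  omega

theorem mem_sixClass_iff_of_sq_eq_zero {n : ℕ} {x : ZMod n} (hx : x * x = 0) (hn : ¬ IsUnit x)
    (y : ZMod n) : y ∈ sixClass x ↔ y = x ∨ y = -x ∨ y = 1 - x ∨ y = 1 + x := by
  have e1 : (1 - x) * (1 + x) = 1 := by linear_combination -hx
  have e2 : (x - 1) * -(1 + x) = 1 := by linear_combination -hx
  have e3 : x * -(1 + x) = -x := by linear_combination -hx
  simp only [sixClass, Set.mem_ofPred_eq, hn, false_and, false_or, IsUnit.of_mul_eq_one _ e1,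
    IsUnit.of_mul_eq_one _ e2, true_and, inv_eq_of_mul_eq_one e1, inv_eq_of_mul_eq_one e2, e3]
  tauto

theorem mem_sixClass_p_mul_iff (k y : ZMod (p ^ 2)) :
    y ∈ sixClass ((p : ZMod (p ^ 2)) * k) ↔ y = (p : ZMod (p ^ 2)) * k ∨
      y = -((p : ZMod (p ^ 2)) * k) ∨ y = 1 - (p : ZMod (p ^ 2)) * k ∨
      y = 1 + (p : ZMod (p ^ 2)) * k :=
  mem_sixClass_iff_of_sq_eq_zero (by linear_combination k ^ 2 * p_mul_p (p := p))
    (by rw [isUnit_iff_red]; simp) y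

/-- For nonunits the `S₃`-action is not available; instead `sixClass` is an equivalence class
because it coincides with `TripleEquiv` of the collinear triples. -/
theorem sixClass_eq_of_mem (h2 : 2 < p) {x y : ZMod (p ^ 2)} (h : y ∈ sixClass x) :
    sixClass y = sixClass x := by
  have hxy := tri_of_mem_sixClass h2 h
  ext z
  exact ⟨fun hz => sixClass_of_tri (hxy.trans (tri_of_mem_sixClass h2 hz)).symm,
    fun hz => sixClass_of_tri (hxy.symm.trans (tri_of_mem_sixClass h2 hz)).symm⟩

theorem isMinOf_sixClass_p_mul (h2 : 2 < p) {κ : ℕ} (hκ : 1 ≤ κ ∧ κ ≤ (p - 1) / 2) :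
    IsMinOf (sixClass ((p : ZMod (p ^ 2)) * (κ : ZMod (p ^ 2)))) (p * κ) := by
  -- The class consists of `± p κ` and `1 ± p κ`; this bound makes `p κ` the smallest of the four
  -- representatives.
  have hle : 2 * (p * κ) + p ≤ p ^ 2 := by
    have : 2 * κ + 1 ≤ p := by omega
    nlinarith
  have hpos : p ≤ p * κ := Nat.le_mul_of_pos_right p hκ.1
  have hcast : ((p * κ : ℕ) : ZMod (p ^ 2)) = (p : ZMod (p ^ 2)) * (κ : ZMod (p ^ 2)) :=
    Nat.cast_mul _ _
  have hval {a : ZMod (p ^ 2)} {b : ℕ} (hb : b < p ^ 2) (e : (b : ZMod (p ^ 2)) = a) :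
      a.val = b := by rw [← e, ZMod.val_cast_of_lt hb]
  refine ⟨⟨_, Or.inl rfl, hval (by omega) hcast⟩, ?_⟩
  rintro _ ⟨y, hy, rfl⟩
  rw [mem_sixClass_p_mul_iff, ← hcast] at hy
  have hneg : ((p ^ 2 - p * κ : ℕ) : ZMod (p ^ 2)) = -((p * κ : ℕ) : ZMod (p ^ 2)) := by
    rw [Nat.cast_sub (by omega), ZMod.natCast_self, zero_sub]
  rcases hy with rfl | rfl | rfl | rfl
  · rw [hval (b := p * κ) (by omega) rfl]
  · rw [hval (b := p ^ 2 - p * κ) (by omega) hneg]; omega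
  · rw [hval (b := p ^ 2 - p * κ + 1) (by omega) (by rw [Nat.cast_add, hneg]; push_cast; ring)]
    omega
  · rw [hval (b := p * κ + 1) (by omega) (by push_cast; ring)]
    omega

theorem exists_p_mul_mem_sixClass (h2 : 2 < p) {s : ZMod (p ^ 2)} (h0 : s ≠ 0) (h1 : s ≠ 1)
    (h : ¬ (IsUnit s ∧ IsUnit (1 - s))) :
    ∃ κ : ℕ, (1 ≤ κ ∧ κ ≤ (p - 1) / 2) ∧
      (p : ZMod (p ^ 2)) * (κ : ZMod (p ^ 2)) ∈ sixClass s := by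
  have key {s : ZMod (p ^ 2)} (h0 : s ≠ 0) (h : red p s = 0) :
      ∃ κ : ℕ, (1 ≤ κ ∧ κ ≤ (p - 1) / 2) ∧
        (p : ZMod (p ^ 2)) * (κ : ZMod (p ^ 2)) ∈ sixClass s := by
    obtain ⟨k, rfl⟩ := (red_eq_zero_iff s).1 h
    have hk : (red p k).val ≠ 0 := by
      rw [Ne, ZMod.val_eq_zero, ← p_mul_eq_zero_iff]; exact h0
    have hlt := ZMod.val_lt (red p k)
    obtain ⟨t, ht⟩ := hp.out.odd_of_ne_two (by omega)
    by_cases hle : (red p k).val ≤ (p - 1) / 2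
    · refine ⟨(red p k).val, ⟨by omega, hle⟩, Or.inl ?_⟩
      exact (p_mul_eq_p_mul_iff _ _).2 (red_residue k)
    · refine ⟨p - (red p k).val, ⟨by omega, by omega⟩, ?_⟩
      rw [mem_sixClass_p_mul_iff, ← mul_neg, p_mul_eq_p_mul_iff (p := p) _ (-k)]
      right; left
      rw [red_natCast, Nat.cast_sub hlt.le, ZMod.natCast_self, ZMod.natCast_zmod_val, zero_sub,
        map_neg]
  by_cases hs : red p s = 0
  · exact key h0 hs
  · have hs' : red p (1 - s) = 0 := by
      by_contra hc
      exact h ⟨(isUnit_iff_red _).2 hs, (isUnit_iff_red _).2 hc⟩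
    obtain ⟨κ, hκ, hm⟩ := key (sub_ne_zero.2 h1.symm) hs'
    refine ⟨κ, hκ, ?_⟩
    rwa [sixClass_eq_of_mem h2 (Or.inr (Or.inr (Or.inl rfl)) : 1 - s ∈ sixClass s)] at hm

/-- If `s` or `1 - s` is a nonunit, the class of `s` contains a multiple of `p`, and up to sign this
is `p κ` with `κ` in the lower half. -/
theorem minima_prime_sq_eq (h2 : 2 < p) :
    {m : ℕ | ∃ s : ℕ, 2 ≤ s ∧ s < p ^ 2 ∧ IsMinOf (sixClass (s : ZMod (p ^ 2))) m} =
      {m : ℕ | ∃ x : UnitPair (p ^ 2), IsMinOf (sixClass x.1) m} ∪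
        (fun κ => p * κ) '' Set.Icc 1 ((p - 1) / 2) := by
  have hsq : 2 ≤ p ^ 2 := by nlinarith
  have : Nontrivial (ZMod (p ^ 2)) := ⟨_, _, p_ne_zero⟩
  have main (m : ℕ) (s : ZMod (p ^ 2)) (h0 : s ≠ 0) (h1 : s ≠ 1) (h : IsMinOf (sixClass s) m) :
      (∃ x : UnitPair (p ^ 2), IsMinOf (sixClass x.1) m) ∨
        m ∈ (fun κ => p * κ) '' Set.Icc 1 ((p - 1) / 2) := by
    by_cases hu : IsUnit s ∧ IsUnit (1 - s)
    · exact Or.inl ⟨⟨s, hu⟩, h⟩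
    · obtain ⟨κ, hκ, hm⟩ := exists_p_mul_mem_sixClass h2 h0 h1 hu
      have h' := isMinOf_sixClass_p_mul h2 hκ
      rw [sixClass_eq_of_mem h2 hm] at h'
      exact Or.inr ⟨κ, hκ, h'.unique h⟩
  have back (m : ℕ) (s : ZMod (p ^ 2)) (h0 : s ≠ 0) (h1 : s ≠ 1) (h : IsMinOf (sixClass s) m) :
      ∃ s : ℕ, 2 ≤ s ∧ s < p ^ 2 ∧ IsMinOf (sixClass (s : ZMod (p ^ 2))) m :=
    ⟨s.val, two_le_val hsq h0 h1, ZMod.val_lt s, by rwa [ZMod.natCast_zmod_val]⟩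
  ext m
  constructor
  · rintro ⟨s, hs2, hs, h⟩
    obtain ⟨h0, h1⟩ := natCast_ne_zero_one hs2 hs
    exact main m s h0 h1 h
  · rintro (⟨x, h⟩ | ⟨κ, hκ, rfl⟩)
    · exact back m x.1 x.2.1.ne_zero (sub_ne_zero.1 x.2.2.ne_zero).symm h
    · refine back _ _ (p_mul_natCast_ne_zero h2 hκ) (fun e => ?_) (isMinOf_sixClass_p_mul h2 hκ)
      have := congrArg (red p) e
      simp at this

theorem card_six_prime_sq (h2 : 2 < p) :
    Nat.card {m : ℕ // ∃ s : ℕ, 2 ≤ s ∧ s < p ^ 2 ∧ IsMinOf (sixClass (s : ZMod (p ^ 2))) m}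
      = (p ^ 2 - 2 * p + 1) / 6 + (p - 1) / 2 + 1 := by
  have h := six_mul_card_minima (isUnit_two h2)
  have hr := card_roots_le_two (roots_prime_sq (p := p))
  rw [card_unitPair_prime_sq] at h
  have e := minima_prime_sq_eq h2
  have hfin : {m : ℕ | ∃ x : UnitPair (p ^ 2), IsMinOf (sixClass x.1) m}.Finite :=
    (Set.finite_lt_nat (p ^ 2)).subset fun m ⟨x, hx⟩ => hx.lt
  have hdisj : Disjoint {m : ℕ | ∃ x : UnitPair (p ^ 2), IsMinOf (sixClass x.1) m}
      ((fun κ => p * κ) '' Set.Icc 1 ((p - 1) / 2)) := by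
    rw [Set.disjoint_left]
    rintro _ ⟨x, hx⟩ ⟨κ, -, rfl⟩
    obtain ⟨hu, -⟩ := (mem_sixClass_iff_orbitRel x _).1 hx.cast_mem
    have := (isUnit_iff_red _).1 hu.1
    simp at this
  have hcard := Set.ncard_union_eq hdisj hfin ((Set.finite_Icc _ _).image _)
  rw [← e, Set.ncard_image_of_injective _ (mul_right_injective₀ (by omega : p ≠ 0)),
    Set.ncard_eq_toFinset_card' (Set.Icc 1 ((p - 1) / 2)), Set.toFinset_Icc, Nat.card_Icc,
    ← Nat.card_coe_set_eq, ← Nat.card_coe_set_eq] at hcard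
  have hcard' : Nat.card {m : ℕ // ∃ s : ℕ, 2 ≤ s ∧ s < p ^ 2 ∧
      IsMinOf (sixClass (s : ZMod (p ^ 2))) m} =
      Nat.card {m : ℕ // ∃ x : UnitPair (p ^ 2), IsMinOf (sixClass x.1) m} +
        ((p - 1) / 2 + 1 - 1) := hcard
  rw [hcard']
  have hle : 2 * p ≤ p ^ 2 := by nlinarith
  rcases prime_mod_six h2 with h3 | h3 | h3
  · subst h3; omega
  · obtain ⟨k, hk⟩ : ∃ k, p = 6 * k + 1 := ⟨p / 6, by omega⟩
    have : p ^ 2 - 2 * p + 1 = 36 * k ^ 2 := by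
      have : p ^ 2 + 1 = 36 * k ^ 2 + 2 * p := by rw [hk]; ring
      omega
    omega
  · obtain ⟨k, hk⟩ : ∃ k, p = 6 * k + 5 := ⟨p / 6, by omega⟩
    have : p ^ 2 - 2 * p + 1 = 36 * k ^ 2 + 48 * k + 16 := by
      have : p ^ 2 + 1 = 36 * k ^ 2 + 48 * k + 16 + 2 * p := by rw [hk]; ring
      omega
    omega

end counting

/-! ### Sizes of the five families and the closed formula. -/

section families

variable {p : ℕ}

/-- The parameters, as a sum type. -/
def repIndexEquiv (p : ℕ) : RepIndex p ≃
    {s : ℕ // 1 ≤ s ∧ s ≤ p ^ 2 / 2} ⊕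
    ({k : ℕ // 1 ≤ k ∧ k ≤ (p - 1) / 2} ×
      {m : ℕ // ∃ s : ℕ, 2 ≤ s ∧ s ≤ p - 1 ∧ IsMinOf (threeClass (s : ZMod p)) m}) ⊕
    {m : ℕ // ∃ s : ℕ, 2 ≤ s ∧ s < p ^ 2 ∧ IsMinOf (sixClass (s : ZMod (p ^ 2))) m} ⊕
    Unit ⊕ {m : ℕ // ∃ s : ℕ, 2 ≤ s ∧ s ≤ p - 1 ∧ IsMinOf (sixClass (s : ZMod p)) m} where
  toFun
    | .M s hs => .inl ⟨s, hs⟩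
    | .Nk k m hk hm => .inr (.inl (⟨k, hk⟩, ⟨m, hm⟩))
    | .N m hm => .inr (.inr (.inl ⟨m, hm⟩))
    | .M₀ => .inr (.inr (.inr (.inl ())))
    | .W m hm => .inr (.inr (.inr (.inr ⟨m, hm⟩)))
  invFun
    | .inl s => .M s.1 s.2
    | .inr (.inl (k, m)) => .Nk k.1 m.1 k.2 m.2
    | .inr (.inr (.inl m)) => .N m.1 m.2
    | .inr (.inr (.inr (.inl ()))) => .M₀
    | .inr (.inr (.inr (.inr m))) => .W m.1 m.2
  left_inv i := by cases i <;> rfl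
  right_inv i := by rcases i with _ | ⟨_, _⟩ | _ | _ | _ <;> rfl

theorem ncard_range_of_injective {α β : Type*} {f : α → β} (hf : Function.Injective f) :
    (Set.range f).ncard = Nat.card α := by
  rw [← Set.image_univ, Set.ncard_image_of_injective _ hf, Set.ncard_univ]

theorem card_Icc_subtype (a : ℕ) : Nat.card {s : ℕ // 1 ≤ s ∧ s ≤ a} = a := by
  have : Nat.card (Set.Icc 1 a) = a := by simp
  exact this

theorem ncard_famM : (famM p).ncard = p ^ 2 / 2 := by
  have e : famM p = Set.range fun s : {s : ℕ // 1 ≤ s ∧ s ≤ p ^ 2 / 2} => RepIndex.M s.1 s.2 := by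
    ext i
    exact ⟨fun ⟨s, hs, h⟩ => ⟨⟨s, hs⟩, h.symm⟩, fun ⟨s, h⟩ => ⟨s.1, s.2, h.symm⟩⟩
  rw [e, ncard_range_of_injective fun a b h => Subtype.ext (by injection h), card_Icc_subtype]

theorem ncard_famM₀ : (famM₀ p).ncard = 1 := Set.ncard_singleton _

variable [hp : Fact p.Prime]

theorem ncard_famNk (h2 : 2 < p) : (famNk p).ncard = (p - 1) / 2 * (2 * (p / 6) + 1) := by
  have e : famNk p = Set.range fun q : {k : ℕ // 1 ≤ k ∧ k ≤ (p - 1) / 2} ×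
      {m : ℕ // ∃ s : ℕ, 2 ≤ s ∧ s ≤ p - 1 ∧ IsMinOf (threeClass (s : ZMod p)) m} =>
        RepIndex.Nk q.1.1 q.2.1 q.1.2 q.2.2 := by
    ext i
    exact ⟨fun ⟨k, m, hk, hm, h⟩ => ⟨(⟨k, hk⟩, ⟨m, hm⟩), h.symm⟩,
      fun ⟨q, h⟩ => ⟨q.1.1, q.2.1, q.1.2, q.2.2, h.symm⟩⟩
  rw [e, ncard_range_of_injective, Nat.card_prod, card_Icc_subtype, card_three_prime h2]
  intro a b h
  injection h with h1 h2
  exact Prod.ext (Subtype.ext h1) (Subtype.ext h2)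

theorem ncard_famN (h2 : 2 < p) :
    (famN p).ncard = (p ^ 2 - 2 * p + 1) / 6 + (p - 1) / 2 + 1 := by
  have e : famN p = Set.range fun m : {m : ℕ // ∃ s : ℕ, 2 ≤ s ∧ s < p ^ 2 ∧
      IsMinOf (sixClass (s : ZMod (p ^ 2))) m} => RepIndex.N m.1 m.2 := by
    ext i
    exact ⟨fun ⟨s, hs, h⟩ => ⟨⟨s, hs⟩, h.symm⟩, fun ⟨s, h⟩ => ⟨s.1, s.2, h.symm⟩⟩
  rw [e, ncard_range_of_injective fun a b h => Subtype.ext (by injection h), card_six_prime_sq h2]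

theorem ncard_famW (h2 : 2 < p) : (famW p).ncard = p / 6 + 1 := by
  have e : famW p = Set.range fun m : {m : ℕ // ∃ s : ℕ, 2 ≤ s ∧ s ≤ p - 1 ∧
      IsMinOf (sixClass (s : ZMod p)) m} => RepIndex.W m.1 m.2 := by
    ext i
    exact ⟨fun ⟨s, hs, h⟩ => ⟨⟨s, hs⟩, h.symm⟩, fun ⟨s, h⟩ => ⟨s.1, s.2, h.symm⟩⟩
  rw [e, ncard_range_of_injective fun a b h => Subtype.ext (by injection h), card_six_prime h2]

theorem card_repIndex (h2 : 2 < p) : Nat.card (RepIndex p) =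
    p ^ 2 / 2 + ((p - 1) / 2 * (2 * (p / 6) + 1) +
      (((p ^ 2 - 2 * p + 1) / 6 + (p - 1) / 2 + 1) + (1 + (p / 6 + 1)))) := by
  have h1 : Finite {s : ℕ // 1 ≤ s ∧ s ≤ p ^ 2 / 2} := (Set.finite_Icc 1 (p ^ 2 / 2)).to_subtype
  have h1' : Finite {s : ℕ // 1 ≤ s ∧ s ≤ (p - 1) / 2} :=
    (Set.finite_Icc 1 ((p - 1) / 2)).to_subtype
  have h3 := card_three_prime h2
  have h4 := card_six_prime_sq h2
  have h5 := card_six_prime h2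
  have := Nat.finite_of_card_ne_zero (h3.trans_ne (Nat.succ_ne_zero _))
  have := Nat.finite_of_card_ne_zero (h4.trans_ne (Nat.succ_ne_zero _))
  have := Nat.finite_of_card_ne_zero (h5.trans_ne (Nat.succ_ne_zero _))
  rw [Nat.card_congr (repIndexEquiv p), Nat.card_sum, Nat.card_sum, Nat.card_sum, Nat.card_sum,
    Nat.card_prod, card_Icc_subtype, card_Icc_subtype, h3, h4, h5, Nat.card_unique]

/-- Apart from `p = 3`, the sign `(-1)^⌊p/3⌋` is `+1` for `p = 6k + 1` and `-1` for `p = 6k + 5`; in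
each case all floors become polynomials in `k`. -/
theorem tripleCount_eq (h2 : 2 < p) : (Nat.card (RepIndex p) : ℤ) = tripleCount p := by
  rw [card_repIndex h2, tripleCount]
  rcases prime_mod_six h2 with h3 | h3 | h3
  · subst h3
    norm_num [Int.floor_eq_iff]
  · obtain ⟨k, rfl⟩ : ∃ k, p = 6 * k + 1 := ⟨p / 6, by omega⟩
    have e1 : (6 * k + 1) / 3 = 2 * k := by omega
    have f1 : ⌊(5 / 6 : ℚ) * ((6 * k + 1 : ℕ) : ℚ) ^ 2⌋ = 30 * k ^ 2 + 10 * k := by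
      rw [Int.floor_eq_iff]; push_cast; constructor <;> nlinarith
    have f2 : ⌊(((6 * k + 1 : ℕ) : ℚ) - 2) / 6 + (-1) ^ ((6 * k + 1) / 3) *
        (((6 * k + 1 : ℕ) : ℚ) / 3)⌋ = 3 * k := by
      rw [e1, pow_mul, neg_one_sq, one_pow, Int.floor_eq_iff]
      push_cast; constructor <;> linarith
    rw [f1, f2]
    have g1 : (6 * k + 1) ^ 2 / 2 = 18 * k ^ 2 + 6 * k := by
      have : (6 * k + 1) ^ 2 = 36 * k ^ 2 + 12 * k + 1 := by ring
      omega
    have g2 : ((6 * k + 1) ^ 2 - 2 * (6 * k + 1) + 1) / 6 = 6 * k ^ 2 := by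
      have : (6 * k + 1) ^ 2 = 36 * k ^ 2 + 12 * k + 1 := by ring
      omega
    have g3 : (6 * k + 1 - 1) / 2 = 3 * k := by omega
    have g4 : (6 * k + 1) / 6 = k := by omega
    rw [g1, g2, g3, g4]
    push_cast; ring
  · obtain ⟨k, rfl⟩ : ∃ k, p = 6 * k + 5 := ⟨p / 6, by omega⟩
    have e1 : (6 * k + 5) / 3 = 2 * k + 1 := by omega
    have f1 : ⌊(5 / 6 : ℚ) * ((6 * k + 5 : ℕ) : ℚ) ^ 2⌋ = 30 * k ^ 2 + 50 * k + 20 := by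
      rw [Int.floor_eq_iff]; push_cast; constructor <;> nlinarith
    have f2 : ⌊(((6 * k + 5 : ℕ) : ℚ) - 2) / 6 + (-1) ^ ((6 * k + 5) / 3) *
        (((6 * k + 5 : ℕ) : ℚ) / 3)⌋ = -k - 2 := by
      rw [e1, pow_succ, pow_mul, neg_one_sq, one_pow, Int.floor_eq_iff]
      push_cast; constructor <;> linarith
    rw [f1, f2]
    have g1 : (6 * k + 5) ^ 2 / 2 = 18 * k ^ 2 + 30 * k + 12 := by
      have : (6 * k + 5) ^ 2 = 36 * k ^ 2 + 60 * k + 25 := by ring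
      omega
    have g2 : ((6 * k + 5) ^ 2 - 2 * (6 * k + 5) + 1) / 6 = 6 * k ^ 2 + 8 * k + 2 := by
      have : (6 * k + 5) ^ 2 = 36 * k ^ 2 + 60 * k + 25 := by ring
      omega
    have g3 : (6 * k + 5 - 1) / 2 = 3 * k + 2 := by omega
    have g4 : (6 * k + 5) / 6 = k := by omega
    rw [g1, g2, g3, g4]
    push_cast; ring

theorem isGBSTriple_repKet (h2 : 2 < p) (i : RepIndex p) : IsGBSTriple (p ^ 2) (repKet p i) :=
  (isGBSTriple_image_iff _).2 (isGPMTriple_rep h2 i)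

theorem existsUnique_repKet (h2 : 2 < p) {T : Set (Ket (p ^ 2))} (hT : IsGBSTriple (p ^ 2) T) :
    ∃! i : RepIndex p, LUEquiv T (repKet p i) := by
  obtain ⟨S, hS, rfl⟩ := hT.exists_image
  simp only [repKet, lUEquiv_image_iff]
  exact existsUnique_rep h2 hS

theorem existsUnique_gpmSetoid (h2 : 2 < p) (T : GPMTriple (p ^ 2)) :
    ∃! i : RepIndex p, gpmSetoid (p ^ 2) T ⟨rep p i, isGPMTriple_rep h2 i⟩ :=
  existsUnique_rep h2 T.2

theorem existsUnique_gbsSetoid (h2 : 2 < p) (T : GBSTriple (p ^ 2)) :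
    ∃! i : RepIndex p, gbsSetoid (p ^ 2) T ⟨repKet p i, isGBSTriple_repKet h2 i⟩ :=
  existsUnique_repKet h2 T.2

theorem ncard_gpmClasses (h2 : 2 < p) (F : Set (RepIndex p)) :
    (gpmClasses (p ^ 2) (rep p '' F)).ncard = F.ncard := by
  rw [← ncard_classes_of_existsUnique (existsUnique_gpmSetoid h2) F, gpmClasses]
  congr 2
  ext T
  exact ⟨fun ⟨i, hi, e⟩ => ⟨i, hi, Subtype.ext e⟩, fun ⟨i, hi, e⟩ => ⟨i, hi, congrArg (·.1) e⟩⟩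

theorem ncard_gbsClasses (h2 : 2 < p) (F : Set (RepIndex p)) :
    (gbsClasses (p ^ 2) (repKet p '' F)).ncard = F.ncard := by
  rw [← ncard_classes_of_existsUnique (existsUnique_gbsSetoid h2) F, gbsClasses]
  congr 2
  ext T
  exact ⟨fun ⟨i, hi, e⟩ => ⟨i, hi, Subtype.ext e⟩, fun ⟨i, hi, e⟩ => ⟨i, hi, congrArg (·.1) e⟩⟩

end families

end GenBell

end

open GenBell in
theorem theorem3 (p : ℕ) [Fact p.Prime] (hp : 2 < p) :
    -- GPM-triples up to U-equivalence
    ((Nat.card (GPMClass (p ^ 2)) : ℤ) = tripleCount p ∧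
      (∀ i : RepIndex p, IsGPMTriple (p ^ 2) (rep p i)) ∧
      (∀ T : Set (Mat (p ^ 2)), IsGPMTriple (p ^ 2) T → ∃! i : RepIndex p, UEquiv T (rep p i)) ∧
      (gpmClasses (p ^ 2) (rep p '' famM p)).ncard = p ^ 2 / 2 ∧
      (gpmClasses (p ^ 2) (rep p '' famNk p)).ncard = (p - 1) / 2 * (2 * (p / 6) + 1) ∧
      (gpmClasses (p ^ 2) (rep p '' famN p)).ncard
        = (p ^ 2 - 2 * p + 1) / 6 + (p - 1) / 2 + 1 ∧
      (gpmClasses (p ^ 2) (rep p '' famM₀ p)).ncard = 1 ∧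
      (gpmClasses (p ^ 2) (rep p '' famW p)).ncard = p / 6 + 1) ∧
    -- GBS-triples up to LU-equivalence
    ((Nat.card (GBSClass (p ^ 2)) : ℤ) = tripleCount p ∧
      (∀ i : RepIndex p, IsGBSTriple (p ^ 2) (repKet p i)) ∧
      (∀ T : Set (Ket (p ^ 2)), IsGBSTriple (p ^ 2) T →
        ∃! i : RepIndex p, LUEquiv T (repKet p i)) ∧
      (gbsClasses (p ^ 2) (repKet p '' famM p)).ncard = p ^ 2 / 2 ∧
      (gbsClasses (p ^ 2) (repKet p '' famNk p)).ncard = (p - 1) / 2 * (2 * (p / 6) + 1) ∧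
      (gbsClasses (p ^ 2) (repKet p '' famN p)).ncard
        = (p ^ 2 - 2 * p + 1) / 6 + (p - 1) / 2 + 1 ∧
      (gbsClasses (p ^ 2) (repKet p '' famM₀ p)).ncard = 1 ∧
      (gbsClasses (p ^ 2) (repKet p '' famW p)).ncard = p / 6 + 1) := by
  refine ⟨⟨?_, isGPMTriple_rep hp, fun _ => existsUnique_rep hp, ?_, ?_, ?_, ?_, ?_⟩,
    ?_, isGBSTriple_repKet hp, fun _ => existsUnique_repKet hp, ?_, ?_, ?_, ?_, ?_⟩
  · rw [card_quotient_of_existsUnique (existsUnique_gpmSetoid hp), tripleCount_eq hp]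
  · rw [ncard_gpmClasses hp, ncard_famM]
  · rw [ncard_gpmClasses hp, ncard_famNk hp]
  · rw [ncard_gpmClasses hp, ncard_famN hp]
  · rw [ncard_gpmClasses hp, ncard_famM₀]
  · rw [ncard_gpmClasses hp, ncard_famW hp]
  · rw [card_quotient_of_existsUnique (existsUnique_gbsSetoid hp), tripleCount_eq hp]
  · rw [ncard_gbsClasses hp, ncard_famM]
  · rw [ncard_gbsClasses hp, ncard_famNk hp]
  · rw [ncard_gbsClasses hp, ncard_famN hp]
  · rw [ncard_gbsClasses hp, ncard_famM₀]
  · rw [ncard_gbsClasses hp, ncard_famW hp]
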